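/- Let $d\ge 2$ and let $g_2,\dots,g_d:[0,\infty)\to[0,\infty)$ be continuous and nondecreasing. Let $(\eta_t)_{t\ge0}$ be the symmetric nearest-neighbour exclusion process on $\mathbb Z^d$, i.e. the $\{0,1\}^{\mathbb Z^d}$-valued process with generator $$\mathcal L_d f(\eta)=\frac1{2d}\sum_{x\in\mathbb Z^d}\sum_{|y-x|=1}\eta(x)(1-\eta(y))\big(f(\eta^{x,y})-f(\eta)\big)$$ on functions $f$ of finitely many coordinates ($\eta^{x,y}$ is $\eta$ with the values at $x$ and $y$ exchanged), started from the deterministic configuration $$\eta_0(x)=\mathbf 1\big(x_1\le 0,\ |x_i|\le g_i(-x_1)\text{ for } i=2,\dots,d\big).$$ Let $\mathbb E_{\{g_i\}}$ denote the expectation for this process. For a function $z=z(t)\in\mathbb R$ of $t\ge0$ put $N_t=\sum_{x\in\mathbb Z^d,\ x_1>z(t)}\eta_t(x)$. Let $\zeta_t$ be the rate-one continuous time simple symmetric random walk on $\mathbb Z$, with $\zeta_0=0$ under $P_0$ (expectation $E_0$). For $A\subset\{2,\dots,d\}$ and $u\ge 0$ let $$G_A(u)=\prod_{i\in A}(2g_i(u)+1),\qquad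 \widehat G_A(u)=\int_0^u\sum_{i\in A}\ \prod_{l\in A\setminus\{i\}}(2g_l(v)+1)\,dv,$$ where empty products are $1$ and empty sums are $0$. Let $U=\{2\le i\le d:\sup_{u\ge0} g_i(u)=\infty\}$ and $B=\{2,\dots,d\}\setminus U$. Then, for each $i\in B$, the limit $L_i=\lim_{u\to\infty}(2\lfloor g_i(u)\rfloor+1)$ exists, and there is a constant $C>0$, depending only on $d$ and $\{g_i\}$, such that for every function $z$ and all $t\ge0$, $$\Big|\mathbb E_{\{g_i\}}[N_t]-\Big(\prod_{i\in B}L_i\Big)E_0\Big[\int_0^{(\zeta_{t/d}-z)_+}G_U(u)\,du\Big]\Big|\le C\Big(E_0\big[G_U(\zeta_{t/d}-z)\mathbf 1(\zeta_{t/d}>z)\big]+E_0\big[\widehat G_U(\zeta_{t/d}-z)\mathbf 1(\zeta_{t/d}>z)\big]\Big).$$ Here all expectations take values in $[0,\infty]$; if the right-hand side is finite then so are both terms on the left, and in general $|a-b|\le c$ means $a\le b+c$ and $b\le a+c$. Moreover, if $z$ is a function such that $\sup_{t\ge0}E_0\big[\int_0^{(\zeta_{t/d}-z)_+}G_U(u)\,du\big]<\infty$,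 and if for each $i\in U$ the function $g_i$ is continuously differentiable on $[0,\infty)$ with $\lim_{u\to\infty}g_i'(u)/g_i(u)=0$, then $$\lim_{t\to\infty}\Big(E_0\big[G_U(\zeta_{t/d}-z)\mathbf 1(\zeta_{t/d}>z)\big]+E_0\big[\widehat G_U(\zeta_{t/d}-z)\mathbf 1(\zeta_{t/d}>z)\big]\Big)=0.$$ -/

import Mathlib

open MeasureTheory ProbabilityTheory Filter Topology Set
open scoped NNReal ENNReal

noncomputable section

/-! ### The continuous time simple symmetric random walk on the integers -/

/-- The law of one step of the simple symmetric random walk: `±1` with probability `1/2` each. -/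
def stepLaw : Measure ℤ :=
  (2⁻¹ : ℝ≥0∞) • Measure.dirac (1 : ℤ) + (2⁻¹ : ℝ≥0∞) • Measure.dirac (-1 : ℤ)

/-- The law of the discrete time simple symmetric random walk from `0` after `m` steps. -/
def walkLaw : ℕ → Measure ℤ
  | 0 => Measure.dirac 0
  | m + 1 => Measure.conv (walkLaw m) stepLaw

/-- The law under `P₀` of `ζ_t`, the continuous time simple symmetric random walk on `ℤ` that
starts at `0` and jumps at rate `1`: the number of jumps up to time `t` is Poisson with mean `t`
and independent of the steps. Thus `E₀[f(ζ_t)]` is the integral of `f` against `srwLaw t`. -/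
def srwLaw (t : ℝ≥0) : Measure ℤ :=
  Measure.sum fun m : ℕ =>
    ENNReal.ofReal (Real.exp (-(t : ℝ)) * (t : ℝ) ^ m / (m.factorial : ℝ)) • walkLaw m

/-! ### The symmetric simple exclusion process on the lattice `ℤ^d` -/

/-- Sites of the lattice `ℤ^d`. -/
abbrev Site (d : ℕ) : Type := Fin d → ℤ

/-- Configurations in `{0,1}^{ℤ^d}`; `true` is an occupied site. The topology is the product
topology and the σ-algebra the product (equivalently, Borel) σ-algebra. -/
abbrev Config (d : ℕ) : Type := Site d → Bool

/-- The occupation variable `η(x)` as a number. -/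
def occ {d : ℕ} (η : Config d) (x : Site d) : ℝ := if η x = true then 1 else 0

/-- The configuration `η^{x,y}`, in which the values at `x` and `y` are exchanged. -/
def exchange {d : ℕ} (η : Config d) (x y : Site d) : Config d := fun u => η (Equiv.swap x y u)

/-- The generator of the symmetric nearest neighbour exclusion process,
`(1/2d) ∑_x ∑_{|y-x|=1} η(x) (1 - η(y)) (f(η^{x,y}) - f(η))`. The neighbours of `x` are `x ± e_i`.
For `f` depending on finitely many sites, only finitely many terms do not vanish. -/
def exclusionGenerator (d : ℕ) (f : Config d → ℝ) (η : Config d) : ℝ :=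
  1 / (2 * (d : ℝ)) * ∑' x : Site d, ∑ i : Fin d, ∑ s ∈ ({1, -1} : Finset ℤ),
    occ η x * (1 - occ η (x + Pi.single i s)) * (f (exchange η x (x + Pi.single i s)) - f η)

/-- `η` is, under `P`, a symmetric simple exclusion process on `ℤ^d` started from `η₀`: a càdlàg
process that solves the martingale problem for the exclusion generator on the functions that depend
on finitely many sites. -/
structure IsExclusionProcess (d : ℕ) {Ω : Type*} [MeasurableSpace Ω] (P : Measure Ω)
    (η : ℝ≥0 → Ω → Config d) (η₀ : Config d) : Prop where
  measurable : ∀ t, Measurable (η t)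
  right_cont : ∀ ω t, ContinuousWithinAt (fun s => η s ω) (Ici t) t
  left_lim : ∀ ω t, ∃ l : Config d, Tendsto (fun s => η s ω) (𝓝[<] t) (𝓝 l)
  initial : ∀ᵐ ω ∂P, η 0 ω = η₀
  martingale : ∀ (f : Config d → ℝ) (S : Finset (Site d)), DependsOn f (S : Set (Site d)) →
    Martingale
      (fun (t : ℝ≥0) ω => f (η t ω) - f (η 0 ω) -
        ∫ s in (0 : ℝ)..(t : ℝ), exclusionGenerator d f (η s.toNNReal ω))
      (Filtration.natural η fun t => (measurable t).stronglyMeasurable) P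

/-- `N(z)`: the number of particles at sites whose first coordinate is larger than `z`. -/
def numBeyond {n : ℕ} (η : Config (n + 1)) (z : ℝ) : ℝ≥0∞ :=
  ∑' x : {x : Site (n + 1) // z < (x 0 : ℝ)}, ENNReal.ofReal (occ η x)

/-! ### Shape functions and initial profiles

The dimension is `d = n + 1`. The first coordinate has index `0`, and the shape function of the
coordinate `i.succ` is `g i`, so that `g` lists `g_2, …, g_d`. Functions on `[0,∞)` are real
functions of which only the restriction to `Ici 0` matters. -/

/-- The initial profile of the shape functions: `x` is occupied exactly if `x_1 ≤ 0` and
`|x_i| ≤ g_i(-x_1)` for `i = 2, …, d`. -/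
def shapeProfile {n : ℕ} (g : Fin n → ℝ → ℝ) : Config (n + 1) := by
  classical
  exact fun x => decide (x 0 ≤ 0 ∧ ∀ i : Fin n, |(x i.succ : ℝ)| ≤ g i (-(x 0 : ℝ)))

/-- `g` is continuously differentiable on `[0,∞)` and `g'(u) / g(u) → 0` as `u → ∞`. -/
def SubexpCondition (g : ℝ → ℝ) : Prop :=
  ContDiffOn ℝ 1 g (Ici 0) ∧ Tendsto (fun u => derivWithin g (Ici 0) u / g u) atTop (𝓝 0)

/-- The set `U` of the indices of the unbounded shape functions. -/
def unboundedIdx {n : ℕ} (g : Fin n → ℝ → ℝ) : Finset (Fin n) := by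
  classical
  exact Finset.univ.filter fun i => ¬ BddAbove (g i '' Ici 0)

/-- `G_A(u) = ∏_{i ∈ A} (2 g_i(u) + 1)`. -/
def bigG {n : ℕ} (g : Fin n → ℝ → ℝ) (A : Finset (Fin n)) (u : ℝ) : ℝ :=
  ∏ i ∈ A, (2 * g i u + 1)

/-- `Ĝ_A(u) = ∫_0^u ∑_{i ∈ A} ∏_{l ∈ A, l ≠ i} (2 g_l(v) + 1) dv`. -/
def hatG {n : ℕ} (g : Fin n → ℝ → ℝ) (A : Finset (Fin n)) (u : ℝ) : ℝ :=
  ∫ v in (0 : ℝ)..u, ∑ i ∈ A, ∏ l ∈ A.erase i, (2 * g l v + 1)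

/-! ### The expectations in the estimate -/

/-- `E₀[∫_0^{(ζ_s - z)_+} G_A(u) du]`. -/
def meanIntG {n : ℕ} (g : Fin n → ℝ → ℝ) (A : Finset (Fin n)) (s : ℝ≥0) (z : ℝ) : ℝ≥0∞ :=
  ∫⁻ k : ℤ, ENNReal.ofReal (∫ u in (0 : ℝ)..(max ((k : ℝ) - z) 0), bigG g A u) ∂(srwLaw s)

/-- `E₀[h(ζ_s - z) 1(ζ_s > z)]`. -/
def meanBeyond (h : ℝ → ℝ) (s : ℝ≥0) (z : ℝ) : ℝ≥0∞ :=
  ∫⁻ k in {k : ℤ | z < (k : ℝ)}, ENNReal.ofReal (h ((k : ℝ) - z)) ∂(srwLaw s)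

/-- `E₀[G_A(ζ_s - z) 1(ζ_s > z)] + E₀[Ĝ_A(ζ_s - z) 1(ζ_s > z)]`. -/
def meanError {n : ℕ} (g : Fin n → ℝ → ℝ) (A : Finset (Fin n)) (s : ℝ≥0) (z : ℝ) : ℝ≥0∞ :=
  meanBeyond (bigG g A) s z + meanBeyond (hatG g A) s z

end

/-! By symmetry of the jumps the quadratic terms cancel when the generator acts on a single
occupation variable (`exclusionGenerator_occ`). The density therefore solves the lattice heat
equation, whose bounded solutions are unique (`heat_eq_tsum`), and equals that of independent walks
(`lintegral_occ_eq`). Summing over the half space $x_1>z$ and moving the walk onto the indicator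
leaves only the first coordinate, a lazy walk at Poisson times, which is $\zeta_{t/d}$. Thus
$\mathbb E[N_t]$ is exactly the mean of `profileCount g` at $\zeta_{t/d}-z$ (`lintegral_numBeyond`),
a sum over the layers $0\le j<w$ of $\prod_i(2\lfloor g_i(j)\rfloor+1)$.

The estimate is then deterministic (`exists_profileCount_bounds`). The floors of bounded shape
functions are eventually constant, and the finitely many earlier layers cost a multiple of $G_U(w)$.
Removing the floor from an unbounded factor changes it by less than $2$; summed over layers this
costs $\widehat G_U(w)$ and a multiple of $G_U(w)$. Passing from the sum of a monotone function to
its integral costs $G_U(w)$. A finite error forces a finite main term because the point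
probabilities of $\zeta$ eventually halve at each site (`meanIntG_lt_top`).

For the limit, slow growth gives $G_U+\widehat G_U\le C_\delta+\delta\int G_U$ for every $\delta>0$,
so the error is at most $C_\delta P_0(\zeta>z)$ plus $\delta$ times a bounded quantity. The
probability vanishes: the walk spreads out (`tendsto_iSup_srwLaw_singleton`), so it is unlikely to
be just beyond $z$, and by Markov's inequality it is unlikely to be far beyond, since
$\int_0^wG_U\ge w$. -/

/-! ### The random walk on the integers -/

/-- The probability that a Poisson variable with mean `t` equals `m`. -/
noncomputable def poissonWeight (t : ℝ≥0) (m : ℕ) : ℝ≥0∞ :=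
  ENNReal.ofReal (Real.exp (-(t : ℝ)) * (t : ℝ) ^ m / (m.factorial : ℝ))

theorem tsum_poissonWeight (t : ℝ≥0) : ∑' m, poissonWeight t m = 1 := by
  have h : HasSum (fun m : ℕ => Real.exp (-(t : ℝ)) * (t : ℝ) ^ m / (m.factorial : ℝ)) 1 := by
    have h1 := (NormedSpace.expSeries_div_hasSum_exp (𝔸 := ℝ) (t : ℝ)).mul_left
      (Real.exp (-(t : ℝ)))
    rw [← Real.exp_eq_exp_ℝ, ← Real.exp_add, neg_add_cancel, Real.exp_zero] at h1
    simpa only [mul_div_assoc] using h1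
  unfold poissonWeight
  rw [← ENNReal.ofReal_tsum_of_nonneg (fun m => by positivity) h.summable, h.tsum_eq,
    ENNReal.ofReal_one]

/-- Poisson thinning: marking the points of a Poisson variable independently yields two independent
Poisson variables. -/
theorem poissonWeight_add_mul_choose (t p q : ℝ≥0) (hpq : q + p = 1) (i j : ℕ) :
    poissonWeight t (i + j) * (((i + j).choose i : ℝ≥0∞) * ((q : ℝ≥0∞) ^ i * (p : ℝ≥0∞) ^ j)) =
      poissonWeight (t * q) i * poissonWeight (t * p) j := by
  have h1 : (((i + j).choose i : ℝ≥0∞) * ((q : ℝ≥0∞) ^ i * (p : ℝ≥0∞) ^ j)) =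
      ENNReal.ofReal (((i + j).choose i : ℝ) * ((q : ℝ) ^ i * (p : ℝ) ^ j)) := by
    rw [ENNReal.ofReal_mul (by positivity), ENNReal.ofReal_mul (by positivity),
      ENNReal.ofReal_pow (by positivity), ENNReal.ofReal_pow (by positivity)]
    simp
  rw [h1]
  unfold poissonWeight
  rw [← ENNReal.ofReal_mul (by positivity), ← ENNReal.ofReal_mul (by positivity)]
  congr 1
  have h2 : (((i + j).choose i : ℕ) : ℝ) * (i.factorial : ℝ) * (j.factorial : ℝ) =
      ((i + j).factorial : ℝ) := by
    have := Nat.add_choose_mul_factorial_mul_factorial i j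
    rw [Nat.choose_symm_add] at *
    exact_mod_cast this
  have hi : (i.factorial : ℝ) ≠ 0 := by positivity
  have hj : (j.factorial : ℝ) ≠ 0 := by positivity
  have hc : (((i + j).choose i : ℕ) : ℝ) ≠ 0 := by
    have := Nat.choose_pos (Nat.le_add_right i j)
    positivity
  have h3 : Real.exp (-(t : ℝ)) = Real.exp (-((t * q : ℝ≥0) : ℝ)) *
      Real.exp (-((t * p : ℝ≥0) : ℝ)) := by
    rw [← Real.exp_add]
    congr 1
    have : (q : ℝ) + p = 1 := by exact_mod_cast hpq
    push_cast
    linear_combination (t : ℝ) * this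
  rw [h3, ← h2]
  push_cast
  field_simp
  ring

/-- One step of the simple symmetric random walk on `ℤ`, acting on functions. -/
noncomputable def walkStep : Module.End ℝ≥0∞ (ℤ → ℝ≥0∞) where
  toFun φ k := 2⁻¹ * (φ (k + 1) + φ (k - 1))
  map_add' φ ψ := by
    ext k
    simp only [Pi.add_apply]
    ring
  map_smul' c φ := by
    ext k
    simp only [Pi.smul_apply, smul_eq_mul, RingHom.id_apply]
    ring

theorem walkStep_apply (φ : ℤ → ℝ≥0∞) (k : ℤ) :
    walkStep φ k = 2⁻¹ * (φ (k + 1) + φ (k - 1)) := rfl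

theorem lintegral_stepLaw (f : ℤ → ℝ≥0∞) : ∫⁻ y, f y ∂stepLaw = 2⁻¹ * (f 1 + f (-1)) := by
  simp [stepLaw, mul_add]

instance : IsProbabilityMeasure stepLaw :=
  ⟨by
    rw [← lintegral_one, lintegral_stepLaw, one_add_one_eq_two]
    exact ENNReal.inv_mul_cancel (by simp) (by simp)⟩

instance isProbabilityMeasure_walkLaw (m : ℕ) : IsProbabilityMeasure (walkLaw m) := by
  induction m with
  | zero => unfold walkLaw; infer_instance
  | succ m ih => unfold walkLaw; infer_instance

theorem lintegral_walkLaw_succ (m : ℕ) (f : ℤ → ℝ≥0∞) :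
    ∫⁻ y, f y ∂(walkLaw (m + 1)) = ∫⁻ y, walkStep f y ∂(walkLaw m) := by
  rw [walkLaw, Measure.lintegral_conv (measurable_of_countable f)]
  refine lintegral_congr fun x => ?_
  rw [lintegral_stepLaw, walkStep_apply, sub_eq_add_neg]

theorem lintegral_walkLaw_add (m : ℕ) (φ : ℤ → ℝ≥0∞) (k : ℤ) :
    ∫⁻ y, φ (k + y) ∂(walkLaw m) = (walkStep ^ m) φ k := by
  induction m generalizing φ with
  | zero => simp [walkLaw]
  | succ m ih =>
    rw [lintegral_walkLaw_succ, pow_succ, Module.End.mul_apply, ← ih]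
    refine lintegral_congr fun y => ?_
    simp only [walkStep_apply, add_assoc, add_sub_assoc]

theorem lintegral_srwLaw (t : ℝ≥0) (f : ℤ → ℝ≥0∞) :
    ∫⁻ y, f y ∂(srwLaw t) = ∑' m, poissonWeight t m * ∫⁻ y, f y ∂(walkLaw m) := by
  rw [srwLaw, lintegral_sum_measure]
  refine tsum_congr fun m => ?_
  rw [lintegral_smul_measure, smul_eq_mul, poissonWeight]

theorem lintegral_srwLaw_add (t : ℝ≥0) (φ : ℤ → ℝ≥0∞) (k : ℤ) :
    ∫⁻ y, φ (k + y) ∂(srwLaw t) = ∑' m, poissonWeight t m * (walkStep ^ m) φ k := by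
  rw [lintegral_srwLaw]
  simp_rw [lintegral_walkLaw_add]

instance (t : ℝ≥0) : IsProbabilityMeasure (srwLaw t) :=
  ⟨by
    rw [← lintegral_one, lintegral_srwLaw]
    simp [tsum_poissonWeight]⟩

theorem tsum_sum_antidiagonal (F : ℕ × ℕ → ℝ≥0∞) :
    ∑' m, ∑ ij ∈ Finset.HasAntidiagonal.antidiagonal m, F ij = ∑' ij, F ij := by
  rw [← (Finset.HasAntidiagonal.sigmaAntidiagonalEquivProd (A := ℕ)).tsum_eq, ENNReal.tsum_sigma']
  refine tsum_congr fun m => ?_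
  rw [tsum_fintype]
  exact (Finset.sum_coe_sort _ F).symm

theorem smul_add_smul_pow_apply {p q : ℝ≥0∞} {A B : Module.End ℝ≥0∞ (ℤ → ℝ≥0∞)}
    (hAB : Commute A B) (m : ℕ) (φ : ℤ → ℝ≥0∞) (k : ℤ) :
    ((q • A + p • B) ^ m) φ k = ∑ ij ∈ Finset.HasAntidiagonal.antidiagonal m,
      (m.choose ij.1 : ℝ≥0∞) * (q ^ ij.1 * p ^ ij.2) * (A ^ ij.1 * B ^ ij.2) φ k := by
  have hc : Commute (q • A) (p • B) := (hAB.smul_left _).smul_right _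
  rw [hc.add_pow', LinearMap.sum_apply, Finset.sum_apply]
  refine Finset.sum_congr rfl fun ij _ => ?_
  rw [smul_pow, smul_pow, smul_mul_smul_comm]
  simp only [nsmul_eq_mul, Module.End.mul_apply, Module.End.natCast_apply, LinearMap.smul_apply,
    Pi.smul_apply, smul_eq_mul]
  ring

/-- Thinning at operator level: as `A` and `B` commute, only their numbers of uses matter, and these
are independent Poisson. It serves both the lazy walk (`A = 1`) and the splitting of the simple walk
into right and left jumps. -/
theorem tsum_poissonWeight_mul_pow (t p q : ℝ≥0) (hpq : q + p = 1)
    {A B : Module.End ℝ≥0∞ (ℤ → ℝ≥0∞)} (hAB : Commute A B) (φ : ℤ → ℝ≥0∞) (k : ℤ) :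
    ∑' m, poissonWeight t m * (((q : ℝ≥0∞) • A + (p : ℝ≥0∞) • B) ^ m) φ k =
      ∑' j, ∑' i, poissonWeight (t * q) i * (poissonWeight (t * p) j *
        (A ^ i * B ^ j) φ k) := by
  have h1 : ∀ m : ℕ, poissonWeight t m * (((q : ℝ≥0∞) • A + (p : ℝ≥0∞) • B) ^ m) φ k =
      ∑ ij ∈ Finset.HasAntidiagonal.antidiagonal m, poissonWeight (t * q) ij.1 *
        (poissonWeight (t * p) ij.2 * (A ^ ij.1 * B ^ ij.2) φ k) := by
    intro m
    rw [smul_add_smul_pow_apply hAB, Finset.mul_sum]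
    refine Finset.sum_congr rfl fun ij hij => ?_
    rw [Finset.HasAntidiagonal.mem_antidiagonal] at hij
    rw [← mul_assoc (poissonWeight (t * q) ij.1), ← poissonWeight_add_mul_choose t p q hpq, hij]
    ring
  simp_rw [h1]
  rw [tsum_sum_antidiagonal fun ij => poissonWeight (t * q) ij.1 * (poissonWeight (t * p) ij.2 *
    (A ^ ij.1 * B ^ ij.2) φ k), ENNReal.tsum_prod', ENNReal.tsum_comm]

/-- The lazy walk, which moves with probability `p` in each step, at Poisson times is the simple
walk run at speed `p`. -/
theorem tsum_poissonWeight_lazy (t p q : ℝ≥0) (hpq : q + p = 1) (φ : ℤ → ℝ≥0∞) (k : ℤ) :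
    ∑' m, poissonWeight t m * (((q : ℝ≥0∞) • (1 : Module.End ℝ≥0∞ (ℤ → ℝ≥0∞)) +
        (p : ℝ≥0∞) • walkStep) ^ m) φ k =
      ∑' j, poissonWeight (t * p) j * (walkStep ^ j) φ k := by
  rw [tsum_poissonWeight_mul_pow t p q hpq (Commute.one_left _)]
  refine tsum_congr fun j => ?_
  simp_rw [one_pow, one_mul]
  rw [ENNReal.tsum_mul_right, tsum_poissonWeight, one_mul]

/-- The translation by `c`, acting on functions on `ℤ`. -/
def shiftOp (c : ℤ) : Module.End ℝ≥0∞ (ℤ → ℝ≥0∞) where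
  toFun φ k := φ (k + c)
  map_add' _ _ := rfl
  map_smul' _ _ := rfl

theorem shiftOp_pow_apply (c : ℤ) (m : ℕ) (φ : ℤ → ℝ≥0∞) (k : ℤ) :
    (shiftOp c ^ m) φ k = φ (k + m * c) := by
  induction m generalizing k with
  | zero => simp
  | succ m ih =>
    rw [pow_succ', Module.End.mul_apply]
    change (shiftOp c ^ m) φ (k + c) = _
    rw [ih]
    congr 1
    push_cast
    ring

theorem walkStep_eq : walkStep = ((2⁻¹ : ℝ≥0) : ℝ≥0∞) • shiftOp 1 +
    ((2⁻¹ : ℝ≥0) : ℝ≥0∞) • shiftOp (-1) := by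
  ext φ k
  rw [ENNReal.coe_inv two_ne_zero]
  exact mul_add _ _ _

theorem commute_shiftOp (a b : ℤ) : Commute (shiftOp a) (shiftOp b) := by
  ext φ k
  change φ (k + a + b) = φ (k + b + a)
  rw [add_right_comm]

theorem shiftOp_pow_mul_apply (i j : ℕ) (φ : ℤ → ℝ≥0∞) (k : ℤ) :
    (shiftOp 1 ^ i * shiftOp (-1) ^ j) φ k = φ (k + (i - j)) := by
  rw [Module.End.mul_apply, shiftOp_pow_apply, shiftOp_pow_apply]
  congr 1
  ring

/-- The random walk is the difference of two independent Poisson variables. -/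
theorem lintegral_srwLaw_eq_poisson (s : ℝ≥0) (φ : ℤ → ℝ≥0∞) :
    ∫⁻ k, φ k ∂(srwLaw s) = ∑' j : ℕ, ∑' i : ℕ, poissonWeight (s * 2⁻¹) i *
      (poissonWeight (s * 2⁻¹) j * φ (i - j)) := by
  have h := lintegral_srwLaw_add s φ 0
  rw [walkStep_eq, tsum_poissonWeight_mul_pow s _ _ (by
    rw [← two_mul]
    exact mul_inv_cancel₀ two_ne_zero) (commute_shiftOp _ _)] at h
  simp_rw [shiftOp_pow_mul_apply, zero_add] at h
  exact h

theorem srwLaw_singleton_natCast (s : ℝ≥0) (k : ℕ) :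
    srwLaw s {(k : ℤ)} =
      ∑' j, poissonWeight (s * 2⁻¹) (j + k) * poissonWeight (s * 2⁻¹) j := by
  rw [← lintegral_indicator_one (measurableSet_singleton _), lintegral_srwLaw_eq_poisson]
  refine tsum_congr fun j => ?_
  rw [tsum_eq_single (j + k)]
  · simp
  · intro i hi
    rw [indicator_of_notMem, mul_zero, mul_zero]
    rw [mem_singleton_iff]
    omega

theorem poissonWeight_succ_le (t : ℝ≥0) {k m : ℕ} (hkm : k ≤ m) :
    poissonWeight t (m + 1) ≤ ENNReal.ofReal (t / (k + 1)) * poissonWeight t m := by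
  rw [poissonWeight, poissonWeight, ← ENNReal.ofReal_mul (by positivity)]
  refine ENNReal.ofReal_le_ofReal ?_
  have h1 : Real.exp (-(t : ℝ)) * (t : ℝ) ^ (m + 1) / ((m + 1).factorial : ℝ) =
      t / (m + 1) * (Real.exp (-(t : ℝ)) * (t : ℝ) ^ m / (m.factorial : ℝ)) := by
    rw [Nat.factorial_succ]
    push_cast
    field_simp
    ring
  rw [h1]
  gcongr

/-- In the series for the difference of two Poisson variables, the upward count is `j + k ≥ k`, so
raising it by one costs the factor in every term. This tail decay is what `meanIntG_lt_top` needs.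
-/
theorem srwLaw_singleton_succ_le (s : ℝ≥0) (k : ℕ) :
    srwLaw s {((k + 1 : ℕ) : ℤ)} ≤
      ENNReal.ofReal ((s * 2⁻¹ : ℝ≥0) / (k + 1)) * srwLaw s {(k : ℤ)} := by
  rw [srwLaw_singleton_natCast, srwLaw_singleton_natCast, ← ENNReal.tsum_mul_left]
  refine ENNReal.tsum_le_tsum fun j => ?_
  rw [← mul_assoc, ← add_assoc]
  exact mul_le_mul_left (poissonWeight_succ_le _ (Nat.le_add_left k j)) _

/-! ### The walk spreads out -/

/-- The left side equals $1$ at $r=0$ and is nonincreasing: the ratio of successive values is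
$(2r+1)(2r+3)/(2r+2)^2\le1$. -/
theorem sq_centralBinom_mul_le (r : ℕ) :
    ((r.centralBinom : ℝ) / 4 ^ r) ^ 2 * (2 * r + 1) ≤ 1 := by
  induction r with
  | zero => simp
  | succ r ih =>
    have h1 : ((r : ℝ) + 1) * ((r + 1).centralBinom : ℝ) =
        2 * (2 * r + 1) * (r.centralBinom : ℝ) := by
      exact_mod_cast Nat.succ_mul_centralBinom_succ r
    have h2 : ((r + 1).centralBinom : ℝ) / 4 ^ (r + 1) =
        (r.centralBinom : ℝ) / 4 ^ r * ((2 * r + 1) / (2 * (r + 1))) := by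
      have h3 : ((r + 1).centralBinom : ℝ) = 2 * (2 * r + 1) * (r.centralBinom : ℝ) / (r + 1) := by
        rw [← h1]
        field_simp
      rw [h3, pow_succ]
      field_simp
      ring
    rw [h2, mul_pow]
    refine le_trans ?_ ih
    rw [mul_assoc]
    refine mul_le_mul_of_nonneg_left ?_ (sq_nonneg _)
    rw [div_pow, div_mul_eq_mul_div, div_le_iff₀ (by positivity)]
    push_cast
    nlinarith [(Nat.cast_nonneg r : (0 : ℝ) ≤ r)]

theorem tendsto_centralBinom_div : Tendsto (fun r : ℕ => (r.centralBinom : ℝ) / 4 ^ r) atTop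
    (𝓝 0) := by
  have h1 : Tendsto (fun r : ℕ => ((r.centralBinom : ℝ) / 4 ^ r) ^ 2) atTop (𝓝 0) := by
    refine squeeze_zero (fun r => sq_nonneg _) (fun r => ?_)
      (tendsto_one_div_add_atTop_nhds_zero_nat (𝕜 := ℝ))
    rw [le_div_iff₀ (by positivity)]
    refine le_trans ?_ (sq_centralBinom_mul_le r)
    gcongr
    linarith [(Nat.cast_nonneg r : (0 : ℝ) ≤ r)]
  have h2 := h1.sqrt
  simp only [Real.sqrt_zero] at h2
  refine h2.congr fun r => Real.sqrt_sq (by positivity)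

theorem walkLaw_singleton_eq (m : ℕ) (k : ℤ) :
    walkLaw m {k} = (walkStep ^ m) (indicator {k} 1) 0 := by
  rw [← lintegral_walkLaw_add, ← lintegral_indicator_one (measurableSet_singleton _)]
  simp_rw [zero_add]

/-- Each new point probability is the average of two old ones. Hence it suffices to bound the
maximum at even times. -/
theorem iSup_walkLaw_singleton_antitone : Antitone fun m : ℕ => ⨆ k : ℤ, walkLaw m {k} := by
  refine antitone_nat_of_succ_le fun m => iSup_le fun k => ?_
  have h : walkLaw (m + 1) {k} = 2⁻¹ * (walkLaw m {k - 1} + walkLaw m {k + 1}) := by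
    rw [← lintegral_indicator_one (measurableSet_singleton _), lintegral_walkLaw_succ]
    simp_rw [walkStep_apply]
    rw [lintegral_const_mul _ (measurable_of_countable _),
      lintegral_add_left (measurable_of_countable _),
      ← lintegral_indicator_one (measurableSet_singleton (k - 1)),
      ← lintegral_indicator_one (measurableSet_singleton (k + 1))]
    congr 2 <;> refine lintegral_congr fun y => ?_ <;>
      simp [indicator_apply, eq_sub_iff_add_eq, sub_eq_iff_eq_add]
  rw [h]
  calc _ ≤ 2⁻¹ * ((⨆ k : ℤ, walkLaw m {k}) + ⨆ k : ℤ, walkLaw m {k}) := by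
        gcongr <;> exact le_iSup (fun k : ℤ => walkLaw m {k}) _
    _ = _ := by rw [← two_mul, ENNReal.inv_mul_cancel_left (by simp) (by simp)]

theorem iSup_walkLaw_two_mul_le (r : ℕ) :
    ⨆ k : ℤ, walkLaw (2 * r) {k} ≤ ENNReal.ofReal ((r.centralBinom : ℝ) / 4 ^ r) := by
  refine iSup_le fun k => ?_
  rw [walkLaw_singleton_eq, walkStep_eq, smul_add_smul_pow_apply (commute_shiftOp _ _)]
  have hc : ∀ ij ∈ Finset.HasAntidiagonal.antidiagonal (2 * r),
      ((2 * r).choose ij.1 : ℝ≥0∞) * ((((2⁻¹ : ℝ≥0) : ℝ≥0∞)) ^ ij.1 *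
        (((2⁻¹ : ℝ≥0) : ℝ≥0∞)) ^ ij.2) ≤ ENNReal.ofReal ((r.centralBinom : ℝ) / 4 ^ r) := by
    intro ij hij
    rw [Finset.HasAntidiagonal.mem_antidiagonal] at hij
    rw [← pow_add, hij, pow_mul, div_eq_mul_inv, ENNReal.ofReal_mul (by positivity),
      ENNReal.ofReal_natCast, ← inv_pow, ENNReal.ofReal_pow (by positivity)]
    have h4 : ((2⁻¹ : ℝ≥0) : ℝ≥0∞) ^ 2 = ENNReal.ofReal (4⁻¹) := by
      rw [← ENNReal.coe_pow, ENNReal.ofReal]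
      congr 1
      rw [← NNReal.coe_inj, Real.coe_toNNReal _ (by norm_num)]
      norm_num
    rw [h4]
    gcongr
    exact_mod_cast Nat.choose_le_centralBinom ij.1 r
  refine (Finset.sum_le_sum fun ij hij => mul_le_mul_left (hc ij hij) _).trans ?_
  rw [← Finset.mul_sum]
  refine mul_le_of_le_one_right' ?_
  simp_rw [shiftOp_pow_mul_apply, zero_add]
  -- The number of up-steps is determined by the endpoint. An inequality suffices: if `k` has the
  -- wrong parity or is out of range, the left side is zero.
  have h1 : ∀ ij ∈ Finset.HasAntidiagonal.antidiagonal (2 * r),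
      indicator {k} (1 : ℤ → ℝ≥0∞) ((ij.1 : ℤ) - ij.2) ≤
        if ij.1 = (k + 2 * r).toNat / 2 then 1 else 0 := by
    intro ij hij
    rw [Finset.HasAntidiagonal.mem_antidiagonal] at hij
    simp only [indicator_apply, mem_singleton_iff, Pi.one_apply]
    split_ifs with h2 h3
    · exact le_rfl
    · omega
    · exact zero_le_one
    · exact le_rfl
  refine (Finset.sum_le_sum h1).trans ?_
  rw [← Finset.sum_filter, Finset.sum_const, nsmul_eq_mul, mul_one]
  have : ((Finset.HasAntidiagonal.antidiagonal (2 * r)).filter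
      fun ij => ij.1 = (k + 2 * r).toNat / 2).card ≤ 1 := by
    refine Finset.card_le_one.2 fun a ha b hb => ?_
    rw [Finset.mem_filter, Finset.HasAntidiagonal.mem_antidiagonal] at ha hb
    refine Prod.ext ?_ ?_ <;> omega
  exact_mod_cast this

theorem tendsto_poissonWeight_atTop (m : ℕ) :
    Tendsto (fun s : ℝ≥0 => poissonWeight s m) atTop (𝓝 0) := by
  have h := (Real.tendsto_pow_mul_exp_neg_atTop_nhds_zero m).comp
    (NNReal.tendsto_coe_atTop.2 tendsto_id)
  have h2 := ENNReal.tendsto_ofReal (h.div_const (m.factorial : ℝ))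
  rw [zero_div, ENNReal.ofReal_zero] at h2
  refine h2.congr fun s => ?_
  simp [poissonWeight, mul_comm]

/-- The largest probability of a single site tends to zero. -/
theorem tendsto_iSup_srwLaw_singleton :
    Tendsto (fun s : ℝ≥0 => ⨆ k : ℤ, srwLaw s {k}) atTop (𝓝 0) := by
  rw [ENNReal.tendsto_nhds_zero]
  intro ε hε
  have hε2 : 0 < ε / 2 := ENNReal.half_pos hε.ne'
  have hb := ENNReal.tendsto_ofReal tendsto_centralBinom_div
  rw [ENNReal.ofReal_zero, ENNReal.tendsto_nhds_zero] at hb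
  obtain ⟨r, hr⟩ := (hb _ hε2).exists
  have hfin : Tendsto (fun s : ℝ≥0 => ∑ m ∈ Finset.range (2 * r), poissonWeight s m) atTop
      (𝓝 0) := by
    have := tendsto_finsetSum (Finset.range (2 * r)) fun m _ => tendsto_poissonWeight_atTop m
    simpa using this
  filter_upwards [ENNReal.tendsto_nhds_zero.1 hfin _ hε2] with s hs
  refine iSup_le fun k => ?_
  -- Split by the number of jumps: fewer than `2 * r` jumps are unlikely for large `s`, and after `2
  -- * r` jumps the walk is already spread out.
  have hle : ∀ m, walkLaw m {k} ≤ (if m ∈ Finset.range (2 * r) then 1 else 0) + ε / 2 := by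
    intro m
    split_ifs with hm
    · exact prob_le_one.trans le_self_add
    · rw [zero_add]
      rw [Finset.mem_range, not_lt] at hm
      exact (le_iSup (fun k : ℤ => walkLaw m {k}) k).trans
        ((iSup_walkLaw_singleton_antitone hm).trans ((iSup_walkLaw_two_mul_le r).trans hr))
  rw [← lintegral_indicator_one (measurableSet_singleton _), lintegral_srwLaw]
  simp_rw [lintegral_indicator_one (measurableSet_singleton k)]
  calc ∑' m, poissonWeight s m * walkLaw m {k} ≤ ∑' m, (poissonWeight s m *
        (if m ∈ Finset.range (2 * r) then 1 else 0) + poissonWeight s m * (ε / 2)) := by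
        refine ENNReal.tsum_le_tsum fun m => ?_
        rw [← mul_add]
        exact mul_le_mul_right (hle m) _
    _ = ∑ m ∈ Finset.range (2 * r), poissonWeight s m + ε / 2 := by
        rw [ENNReal.tsum_add, ENNReal.tsum_mul_right, tsum_poissonWeight, one_mul,
          tsum_eq_sum (s := Finset.range (2 * r)) fun m hm => by simp [hm]]
        congr 1
        exact Finset.sum_congr rfl fun m hm => by simp [hm]
    _ ≤ ε / 2 + ε / 2 := by gcongr
    _ = ε := ENNReal.add_halves ε

/-! ### Averages over the neighbours on the lattice -/

/-- The sum of `f` over the neighbours of `x`. -/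
def nbrSum {d : ℕ} {R : Type*} [AddCommMonoid R] (f : Site d → R) (x : Site d) : R :=
  ∑ i : Fin d, ∑ s ∈ ({1, -1} : Finset ℤ), f (x + Pi.single i s)

/-- One step of the simple random walk on `ℤ^d`, acting on nonnegative functions. -/
noncomputable def latticeStep (d : ℕ) : Module.End ℝ≥0∞ (Site d → ℝ≥0∞) where
  toFun f x := (2 * (d : ℝ≥0∞))⁻¹ * nbrSum f x
  map_add' f h := by
    ext x
    simp only [nbrSum, Pi.add_apply, Finset.sum_add_distrib, mul_add]
  map_smul' c f := by
    ext x
    simp only [nbrSum, Pi.smul_apply, smul_eq_mul, RingHom.id_apply, ← Finset.mul_sum]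
    ring

theorem latticeStep_apply (d : ℕ) (f : Site d → ℝ≥0∞) (x : Site d) :
    latticeStep d f x = (2 * (d : ℝ≥0∞))⁻¹ * nbrSum f x := rfl

/-- One step of the simple random walk on `ℤ^d`, acting on real functions. -/
noncomputable def latticeStepReal (d : ℕ) : Module.End ℝ (Site d → ℝ) where
  toFun f x := (2 * (d : ℝ))⁻¹ * nbrSum f x
  map_add' f h := by
    ext x
    simp only [nbrSum, Pi.add_apply, Finset.sum_add_distrib, mul_add]
  map_smul' c f := by
    ext x
    simp only [nbrSum, Pi.smul_apply, smul_eq_mul, RingHom.id_apply, ← Finset.mul_sum]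
    ring

theorem latticeStepReal_apply (d : ℕ) (f : Site d → ℝ) (x : Site d) :
    latticeStepReal d f x = (2 * (d : ℝ))⁻¹ * nbrSum f x := rfl

theorem nbrSum_const (d : ℕ) (c : ℝ) (x : Site d) : nbrSum (fun _ => c) x = 2 * d * c := by
  simp [nbrSum]
  ring

theorem latticeStepReal_mono {d : ℕ} {f h : Site d → ℝ} (hfh : ∀ x, f x ≤ h x) (x : Site d) :
    latticeStepReal d f x ≤ latticeStepReal d h x := by
  simp only [latticeStepReal_apply, nbrSum]
  gcongr
  exact hfh _

theorem latticeStepReal_const {d : ℕ} (hd : 1 ≤ d) (c : ℝ) (x : Site d) :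
    latticeStepReal d (fun _ => c) x = c := by
  have : (d : ℝ) ≠ 0 := by positivity
  rw [latticeStepReal_apply, nbrSum_const]
  field_simp

theorem abs_latticeStepReal_le {d : ℕ} (hd : 1 ≤ d) {f : Site d → ℝ} {c : ℝ}
    (hf : ∀ x, |f x| ≤ c) (x : Site d) : |latticeStepReal d f x| ≤ c := by
  rw [abs_le]
  constructor
  · rw [← latticeStepReal_const hd (-c) x]
    exact latticeStepReal_mono (fun y => (abs_le.1 (hf y)).1) x
  · rw [← latticeStepReal_const hd c x]
    exact latticeStepReal_mono (fun y => (abs_le.1 (hf y)).2) x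

theorem latticeStepReal_pow_nonneg {d : ℕ} {f : Site d → ℝ} (hf : ∀ x, 0 ≤ f x) (m : ℕ)
    (x : Site d) : 0 ≤ (latticeStepReal d ^ m) f x := by
  induction m generalizing x with
  | zero => simpa using hf x
  | succ m ih =>
    rw [pow_succ', Module.End.mul_apply, latticeStepReal_apply, nbrSum]
    exact mul_nonneg (by positivity)
      (Finset.sum_nonneg fun i _ => Finset.sum_nonneg fun s _ => ih _)

theorem abs_latticeStepReal_pow_le {d : ℕ} (hd : 1 ≤ d) {f : Site d → ℝ} {c : ℝ}
    (hf : ∀ x, |f x| ≤ c) (m : ℕ) (x : Site d) : |(latticeStepReal d ^ m) f x| ≤ c := by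
  induction m generalizing x with
  | zero => simpa using hf x
  | succ m ih =>
    rw [pow_succ', Module.End.mul_apply]
    exact abs_latticeStepReal_le hd ih x

/-- Links the two versions of the step operator: the heat equation needs subtraction, hence real
values, while the sums over the lattice are taken in `ℝ≥0∞`, where they always exist. -/
theorem ofReal_latticeStepReal_pow {d : ℕ} (hd : 1 ≤ d) {f : Site d → ℝ} (hf : ∀ x, 0 ≤ f x)
    (m : ℕ) (x : Site d) :
    ENNReal.ofReal ((latticeStepReal d ^ m) f x) =
      (latticeStep d ^ m) (fun y => ENNReal.ofReal (f y)) x := by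
  induction m generalizing x with
  | zero => simp
  | succ m ih =>
    have h0 := latticeStepReal_pow_nonneg hf m
    rw [pow_succ', pow_succ', Module.End.mul_apply, Module.End.mul_apply, latticeStepReal_apply,
      latticeStep_apply, ENNReal.ofReal_mul (by positivity),
      ENNReal.ofReal_inv_of_pos (by positivity), ENNReal.ofReal_mul (by positivity)]
    congr 1
    · simp
    · rw [nbrSum, nbrSum, ENNReal.ofReal_sum_of_nonneg fun i _ => Finset.sum_nonneg fun s _ => h0 _]
      refine Finset.sum_congr rfl fun i _ => ?_
      rw [ENNReal.ofReal_sum_of_nonneg fun s _ => h0 _]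
      exact Finset.sum_congr rfl fun s _ => ih _

/-- The first coordinate of one step of the simple random walk on `ℤ^{n+1}`. -/
noncomputable def lazyStep (n : ℕ) : Module.End ℝ≥0∞ (ℤ → ℝ≥0∞) :=
  (((n : ℝ≥0) / ((n + 1 : ℕ) : ℝ≥0) : ℝ≥0) : ℝ≥0∞) • 1 +
    (((1 : ℝ≥0) / ((n + 1 : ℕ) : ℝ≥0) : ℝ≥0) : ℝ≥0∞) • walkStep

/-- Of the $2(n+1)$ neighbours of a site, two change the first coordinate and $2n$ keep it. -/
theorem lazyStep_apply (n : ℕ) (φ : ℤ → ℝ≥0∞) (k : ℤ) :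
    lazyStep n φ k = (2 * ((n + 1 : ℕ) : ℝ≥0∞))⁻¹ * (φ (k - 1) + φ (k + 1) + n * (φ k + φ k)) := by
  have h2 : (2 * ((n + 1 : ℕ) : ℝ≥0∞))⁻¹ = 2⁻¹ * ((n + 1 : ℕ) : ℝ≥0∞)⁻¹ :=
    ENNReal.mul_inv (by simp) (by simp)
  have h3 : (2⁻¹ : ℝ≥0∞) * 2 = 1 := ENNReal.inv_mul_cancel (by simp) (by simp)
  rw [lazyStep, h2, ENNReal.coe_div (by positivity), ENNReal.coe_div (by positivity)]
  simp only [LinearMap.add_apply, LinearMap.smul_apply, Pi.add_apply, Pi.smul_apply,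
    Module.End.one_apply, smul_eq_mul, walkStep_apply, div_eq_mul_inv, ENNReal.coe_natCast,
    ENNReal.coe_one]
  calc _ = 1 * (n * ((n + 1 : ℕ) : ℝ≥0∞)⁻¹ * φ k) +
        1 * ((n + 1 : ℕ) : ℝ≥0∞)⁻¹ * (2⁻¹ * (φ (k + 1) + φ (k - 1))) := by simp only [one_mul]
    _ = 2⁻¹ * 2 * (n * ((n + 1 : ℕ) : ℝ≥0∞)⁻¹ * φ k) +
        1 * ((n + 1 : ℕ) : ℝ≥0∞)⁻¹ * (2⁻¹ * (φ (k + 1) + φ (k - 1))) := by rw [h3]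
    _ = _ := by ring

/-- The lattice step is self-adjoint for counting measure, by translating the sum in each direction,
and on functions of the first coordinate it acts as `lazyStep`. -/
theorem tsum_mul_latticeStep (n : ℕ) (φ : ℤ → ℝ≥0∞) (h : Site (n + 1) → ℝ≥0∞) :
    ∑' x, φ (x 0) * latticeStep (n + 1) h x = ∑' x, lazyStep n φ (x 0) * h x := by
  have key : ∀ (i : Fin (n + 1)) (s : ℤ), ∑' x : Site (n + 1), φ (x 0) * h (x + Pi.single i s) =
      ∑' x : Site (n + 1), φ ((x - (Pi.single i s : Site (n + 1))) 0) * h x := by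
    intro i s
    rw [← (Equiv.addRight (Pi.single i s : Site (n + 1))).tsum_eq fun x : Site (n + 1) =>
      φ ((x - (Pi.single i s : Site (n + 1))) 0) * h x]
    simp
  have hL : ∀ x : Site (n + 1), φ (x 0) * latticeStep (n + 1) h x =
      (2 * ((n + 1 : ℕ) : ℝ≥0∞))⁻¹ * ∑ i : Fin (n + 1), ∑ s ∈ ({1, -1} : Finset ℤ),
        φ (x 0) * h (x + Pi.single i s) := by
    intro x
    rw [latticeStep_apply, nbrSum]
    simp_rw [← Finset.mul_sum]
    ring
  simp_rw [hL, ENNReal.tsum_mul_left]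
  rw [Summable.tsum_finsetSum fun _ _ => ENNReal.summable]
  simp_rw [fun i : Fin (n + 1) => Summable.tsum_finsetSum (s := ({1, -1} : Finset ℤ))
    (f := fun s (x : Site (n + 1)) => φ (x 0) * h (x + Pi.single i s))
    fun _ _ => ENNReal.summable, key]
  simp_rw [← fun i : Fin (n + 1) => Summable.tsum_finsetSum (s := ({1, -1} : Finset ℤ))
    (f := fun s (x : Site (n + 1)) => φ ((x - (Pi.single i s : Site (n + 1))) 0) * h x)
    fun _ _ => ENNReal.summable]
  rw [← Summable.tsum_finsetSum fun _ _ => ENNReal.summable, ← ENNReal.tsum_mul_left]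
  refine tsum_congr fun x => ?_
  rw [lazyStep_apply, Fin.sum_univ_succ]
  simp
  ring

theorem tsum_mul_latticeStep_pow (n m : ℕ) (φ : ℤ → ℝ≥0∞) (h : Site (n + 1) → ℝ≥0∞) :
    ∑' x, φ (x 0) * (latticeStep (n + 1) ^ m) h x = ∑' x, (lazyStep n ^ m) φ (x 0) * h x := by
  induction m generalizing φ with
  | zero => simp
  | succ m ih =>
    simp_rw [pow_succ' (latticeStep (n + 1)), pow_succ (lazyStep n), Module.End.mul_apply]
    rw [tsum_mul_latticeStep, ih]

/-- The random walk on `ℤ^{n+1}` at rate one has as first coordinate the random walk on `ℤ` at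
rate `1/(n+1)`. -/
theorem tsum_mul_poisson_latticeStep (n : ℕ) (t : ℝ≥0) (φ : ℤ → ℝ≥0∞) (h : Site (n + 1) → ℝ≥0∞) :
    ∑' x, φ (x 0) * ∑' m, poissonWeight t m * (latticeStep (n + 1) ^ m) h x =
      ∑' x, (∫⁻ k, φ (x 0 + k) ∂(srwLaw (t / ((n + 1 : ℕ) : ℝ≥0)))) * h x := by
  simp_rw [← ENNReal.tsum_mul_left]
  rw [ENNReal.tsum_comm]
  have hpq : (n : ℝ≥0) / ((n + 1 : ℕ) : ℝ≥0) + 1 / ((n + 1 : ℕ) : ℝ≥0) = 1 := by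
    rw [← add_div]
    push_cast
    exact div_self (by positivity)
  have h1 : ∀ m, ∑' x : Site (n + 1), φ (x 0) * (poissonWeight t m *
      (latticeStep (n + 1) ^ m) h x) =
      ∑' x : Site (n + 1), poissonWeight t m * (lazyStep n ^ m) φ (x 0) * h x := by
    intro m
    simp_rw [mul_left_comm _ (poissonWeight t m), mul_assoc]
    rw [ENNReal.tsum_mul_left, tsum_mul_latticeStep_pow, ENNReal.tsum_mul_left]
  simp_rw [h1]
  rw [ENNReal.tsum_comm]
  refine tsum_congr fun x => ?_
  rw [ENNReal.tsum_mul_right, lintegral_srwLaw_add, lazyStep, tsum_poissonWeight_lazy t _ _ hpq,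
    mul_one_div]

/-! ### One-point functions of the exclusion process -/

theorem occ_nonneg {d : ℕ} (η : Config d) (x : Site d) : 0 ≤ occ η x := by
  unfold occ
  split_ifs <;> norm_num

theorem occ_le_one {d : ℕ} (η : Config d) (x : Site d) : occ η x ≤ 1 := by
  unfold occ
  split_ifs <;> norm_num

theorem abs_occ_le_one {d : ℕ} (η : Config d) (x : Site d) : |occ η x| ≤ 1 := by
  rw [abs_of_nonneg (occ_nonneg η x)]
  exact occ_le_one η x

theorem occ_mul_self {d : ℕ} (η : Config d) (x : Site d) : occ η x * occ η x = occ η x := by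
  unfold occ
  split_ifs <;> norm_num

theorem occ_exchange {d : ℕ} (η : Config d) (x y u : Site d) :
    occ (exchange η x y) u = occ η (Equiv.swap x y u) := rfl

theorem continuous_occ {d : ℕ} (x : Site d) : Continuous fun η : Config d => occ η x :=
  (continuous_of_discreteTopology (f := fun b : Bool => if b = true then (1 : ℝ) else 0)).comp
    (continuous_apply x)

theorem measurable_occ {d : ℕ} (x : Site d) : Measurable fun η : Config d => occ η x :=
  (measurable_of_countable fun b : Bool => if b = true then (1 : ℝ) else 0).comp
    (measurable_pi_apply x)

/-- Among jumps in direction `e`, only the one leaving `x` and the one arriving at `x` from `x - e`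
affect the occupation of `x`. -/
theorem hasSum_exclusion_edge {d : ℕ} (η : Config d) (x e : Site d) (he : e ≠ 0) :
    HasSum (fun y : Site d => occ η y * (1 - occ η (y + e)) *
      (occ (exchange η y (y + e)) x - occ η x))
      (-(occ η x * (1 - occ η (x + e))) + occ η (x - e) * (1 - occ η x)) := by
  have hne : x ≠ x - e := fun h => he (sub_eq_self.1 h.symm)
  have h := hasSum_sum_of_ne_finset_zero (L := .unconditional _) (s := {x, x - e})
    (f := fun y : Site d => occ η y * (1 - occ η (y + e)) *
      (occ (exchange η y (y + e)) x - occ η x)) (by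
      intro y hy
      simp only [Finset.mem_insert, Finset.mem_singleton, not_or] at hy
      have h2 : x ≠ y + e := fun h => hy.2 (by rw [h, add_sub_cancel_right])
      rw [occ_exchange, Equiv.swap_apply_of_ne_of_ne (Ne.symm hy.1) h2, sub_self, mul_zero])
  rw [Finset.sum_pair hne] at h
  convert h using 1
  simp only [occ_exchange, sub_add_cancel, Equiv.swap_apply_left, Equiv.swap_apply_right]
  -- The two sides agree modulo the relation $\eta^2=\eta$ at the three sites involved.
  linear_combination (1 - occ η (x + e)) * occ_mul_self η x +
    occ η x * occ_mul_self η (x + e) - (1 - occ η x) * occ_mul_self η (x - e) -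
    occ η (x - e) * occ_mul_self η x

/-- Adding the directions $e$ and $-e$ cancels the products $\eta(x)\eta(x\pm e)$. The exclusion
rule thus disappears and the one-point function satisfies a closed linear equation. -/
theorem exclusionGenerator_occ {d : ℕ} (hd : 1 ≤ d) (x : Site d) (η : Config d) :
    exclusionGenerator d (fun η => occ η x) η = (latticeStepReal d - 1) (occ η) x := by
  have h : HasSum (fun y : Site d => ∑ i : Fin d, ∑ s ∈ ({1, -1} : Finset ℤ),
      occ η y * (1 - occ η (y + Pi.single i s)) *
        (occ (exchange η y (y + Pi.single i s)) x - occ η x))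
      (∑ i : Fin d, ∑ s ∈ ({1, -1} : Finset ℤ),
        (-(occ η x * (1 - occ η (x + Pi.single i s))) +
          occ η (x - Pi.single i s) * (1 - occ η x))) := by
    refine hasSum_sum fun i _ => hasSum_sum fun s hs => hasSum_exclusion_edge η x _ ?_
    have : s ≠ 0 := by
      rintro rfl
      simp at hs
    simpa using this
  have h2 : ∑ i : Fin d, ∑ s ∈ ({1, -1} : Finset ℤ),
        (-(occ η x * (1 - occ η (x + Pi.single i s))) +
          occ η (x - Pi.single i s) * (1 - occ η x)) =
      nbrSum (occ η) x - nbrSum (fun _ => occ η x) x := by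
    rw [nbrSum, nbrSum, ← Finset.sum_sub_distrib]
    refine Finset.sum_congr rfl fun i _ => ?_
    rw [Finset.sum_pair (by norm_num), Finset.sum_pair (by norm_num),
      Finset.sum_pair (by norm_num)]
    simp only [Pi.single_neg, sub_neg_eq_add, ← sub_eq_add_neg]
    ring
  have hd' : (d : ℝ) ≠ 0 := by positivity
  rw [exclusionGenerator, h.tsum_eq, h2, nbrSum_const, LinearMap.sub_apply, Pi.sub_apply,
    latticeStepReal_apply, Module.End.one_apply]
  field_simp

/-! ### Bounded solutions of the lattice heat equation. -/

theorem abs_latticeLaplacian_le {d : ℕ} (hd : 1 ≤ d) {f : Site d → ℝ} {c : ℝ}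
    (hf : ∀ x, |f x| ≤ c) (x : Site d) : |(latticeStepReal d - 1) f x| ≤ 2 * c := by
  rw [LinearMap.sub_apply, Pi.sub_apply, Module.End.one_apply, two_mul]
  exact (abs_sub _ _).trans (add_le_add (abs_latticeStepReal_le hd hf x) (hf x))

/-- Taylor expansion of a bounded solution of the heat equation on the lattice. -/
theorem abs_heat_sub_taylor_le {d : ℕ} (hd : 1 ≤ d) (u : ℝ → Site d → ℝ) (u₀ : Site d → ℝ)
    (hmeas : ∀ x, Measurable fun s => u s x) (hbd : ∀ s x, |u s x| ≤ 1)
    (heq : ∀ t, 0 ≤ t → ∀ x, u t x = u₀ x + ∫ s in (0 : ℝ)..t, (latticeStepReal d - 1) (u s) x)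
    (n : ℕ) (t : ℝ) (ht : 0 ≤ t) (x : Site d) :
    |u t x - ∑ m ∈ Finset.range n, t ^ m / (m.factorial : ℝ) *
      ((latticeStepReal d - 1) ^ m) u₀ x| ≤ (2 * t) ^ n / (n.factorial : ℝ) := by
  induction n generalizing t x with
  | zero => simpa using hbd t x
  | succ n ih =>
    set D := latticeStepReal d - 1 with hD
    have hDmeas : Measurable fun s => D (u s) x := by
      simp only [hD, LinearMap.sub_apply, Pi.sub_apply, Module.End.one_apply,
        latticeStepReal_apply, nbrSum]
      fun_prop
    have hDint : IntervalIntegrable (fun s => D (u s) x) volume 0 t := by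
      rw [intervalIntegrable_iff]
      refine Measure.integrableOn_of_bounded (M := 2 * 1) (by simp)
        hDmeas.aestronglyMeasurable (ae_of_all _ fun s => ?_)
      exact abs_latticeLaplacian_le hd (hbd s) x
    have hpoly : ∀ m : ℕ, ∫ s in (0 : ℝ)..t, s ^ m / (m.factorial : ℝ) * (D ^ (m + 1)) u₀ x =
        t ^ (m + 1) / ((m + 1).factorial : ℝ) * (D ^ (m + 1)) u₀ x := by
      intro m
      rw [intervalIntegral.integral_mul_const, intervalIntegral.integral_div, integral_pow,
        Nat.factorial_succ]
      push_cast
      have : (m.factorial : ℝ) ≠ 0 := by positivity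
      field_simp
      simp
    -- Each Taylor remainder is the time integral of the Laplacian of the previous one. The
    -- Laplacian at most doubles a uniform bound, which turns $(2s)^n/n!$ into $(2t)^{n+1}/(n+1)!$.
    have hrec : u t x - ∑ m ∈ Finset.range (n + 1), t ^ m / (m.factorial : ℝ) * (D ^ m) u₀ x =
        ∫ s in (0 : ℝ)..t, D (fun y => u s y -
          ∑ m ∈ Finset.range n, s ^ m / (m.factorial : ℝ) * (D ^ m) u₀ y) x := by
      have h1 : ∀ s : ℝ, D (fun y => u s y -
          ∑ m ∈ Finset.range n, s ^ m / (m.factorial : ℝ) * (D ^ m) u₀ y) x =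
          D (u s) x - ∑ m ∈ Finset.range n, s ^ m / (m.factorial : ℝ) * (D ^ (m + 1)) u₀ x := by
        intro s
        have : (fun y => u s y -
          ∑ m ∈ Finset.range n, s ^ m / (m.factorial : ℝ) * (D ^ m) u₀ y) =
          u s - ∑ m ∈ Finset.range n, (s ^ m / (m.factorial : ℝ)) • (D ^ m) u₀ := by
          ext y
          simp
        rw [this, map_sub, map_sum]
        simp [pow_succ']
      simp_rw [h1]
      rw [intervalIntegral.integral_sub hDint
        (Continuous.intervalIntegrable (by fun_prop) _ _),
        intervalIntegral.integral_finsetSum fun m _ =>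
          Continuous.intervalIntegrable (by fun_prop) _ _]
      simp_rw [hpoly]
      rw [Finset.sum_range_succ', heq t ht x]
      simp
      ring
    rw [hrec]
    have hb : ‖∫ s in (0 : ℝ)..t, D (fun y => u s y -
          ∑ m ∈ Finset.range n, s ^ m / (m.factorial : ℝ) * (D ^ m) u₀ y) x‖ ≤
        ∫ s in (0 : ℝ)..t, 2 * ((2 * s) ^ n / (n.factorial : ℝ)) := by
      refine intervalIntegral.norm_integral_le_of_norm_le ht (ae_of_all _ fun s hs => ?_)
        (Continuous.intervalIntegrable (by fun_prop) _ _)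
      exact abs_latticeLaplacian_le hd (fun y => ih s hs.1.le y) x
    refine hb.trans_eq ?_
    simp_rw [mul_pow]
    rw [intervalIntegral.integral_const_mul, intervalIntegral.integral_div,
      intervalIntegral.integral_const_mul, integral_pow, Nat.factorial_succ]
    push_cast
    have : (n.factorial : ℝ) ≠ 0 := by positivity
    field_simp
    simp
    ring

/-- This is $e^{t(A-1)}=e^{tA}e^{-t}$ for the step operator $A$, obtained as a Cauchy product of
absolutely convergent series. -/
theorem hasSum_latticeLaplacian_exp {d : ℕ} (hd : 1 ≤ d) {u₀ : Site d → ℝ}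
    (hu₀ : ∀ x, |u₀ x| ≤ 1) (t : ℝ) (x : Site d) :
    HasSum (fun m : ℕ => t ^ m / (m.factorial : ℝ) * ((latticeStepReal d - 1) ^ m) u₀ x)
      ((∑' m : ℕ, t ^ m / (m.factorial : ℝ) * (latticeStepReal d ^ m) u₀ x) *
        Real.exp (-t)) := by
  have hpow : ∀ m : ℕ, t ^ m / (m.factorial : ℝ) * ((latticeStepReal d - 1) ^ m) u₀ x =
      ∑ ij ∈ Finset.HasAntidiagonal.antidiagonal m,
        (t ^ ij.1 / (ij.1.factorial : ℝ) * (latticeStepReal d ^ ij.1) u₀ x) *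
          ((-t) ^ ij.2 / (ij.2.factorial : ℝ)) := by
    intro m
    have hc : Commute (latticeStepReal d) (-1) := by
      rw [commute_iff_eq]
      ext f y
      simp
    rw [sub_eq_add_neg, hc.add_pow', LinearMap.sum_apply, Finset.sum_apply,
      Finset.mul_sum]
    refine Finset.sum_congr rfl fun ij hij => ?_
    rw [Finset.HasAntidiagonal.mem_antidiagonal] at hij
    have h1 : ((-1 : Module.End ℝ (Site d → ℝ)) ^ ij.2) = ((-1 : ℝ) ^ ij.2) • 1 := by
      rw [← neg_one_smul ℝ (1 : Module.End ℝ (Site d → ℝ)), smul_pow, one_pow]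
    have h2 : ((m.choose ij.1 : ℕ) : ℝ) * (ij.1.factorial : ℝ) * (ij.2.factorial : ℝ) =
        (m.factorial : ℝ) := by
      have := Nat.add_choose_mul_factorial_mul_factorial ij.1 ij.2
      rw [← Nat.choose_symm_add, hij] at this
      exact_mod_cast this
    have hi : (ij.1.factorial : ℝ) ≠ 0 := by positivity
    have hj : (ij.2.factorial : ℝ) ≠ 0 := by positivity
    have hm : (m.factorial : ℝ) ≠ 0 := by positivity
    have h3 : (m.choose ij.1 : ℝ) / (m.factorial : ℝ) =
        1 / ((ij.1.factorial : ℝ) * (ij.2.factorial : ℝ)) := by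
      rw [div_eq_div_iff hm (by positivity), one_mul, ← h2, mul_assoc]
    rw [h1, mul_smul_comm, mul_one]
    simp only [nsmul_eq_mul, Module.End.mul_apply, Module.End.natCast_apply, LinearMap.smul_apply,
      Pi.smul_apply, smul_eq_mul]
    rw [← hij, pow_add, hij, neg_pow t]
    calc _ = t ^ ij.1 * t ^ ij.2 * ((-1) ^ ij.2 * (latticeStepReal d ^ ij.1) u₀ x) *
          ((m.choose ij.1 : ℝ) / (m.factorial : ℝ)) := by ring
      _ = _ := by
        rw [h3]
        field_simp
  have hs1 : Summable fun m : ℕ =>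
      ‖t ^ m / (m.factorial : ℝ) * (latticeStepReal d ^ m) u₀ x‖ := by
    refine Summable.of_nonneg_of_le (fun _ => norm_nonneg _) (fun m => ?_)
      (Real.summable_pow_div_factorial |t|)
    rw [norm_mul, norm_div, norm_pow, Real.norm_eq_abs, Real.norm_natCast]
    exact mul_le_of_le_one_right (by positivity) (abs_latticeStepReal_pow_le hd hu₀ m x)
  have hs2 : Summable fun m : ℕ => ‖(-t) ^ m / (m.factorial : ℝ)‖ :=
    (Real.summable_pow_div_factorial (-t)).norm
  have he : ∑' m : ℕ, (-t) ^ m / (m.factorial : ℝ) = Real.exp (-t) := by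
    rw [Real.exp_eq_exp_ℝ, NormedSpace.exp_eq_tsum_div]
  simp_rw [hpow]
  rw [← he, tsum_mul_tsum_eq_tsum_sum_antidiagonal_of_summable_norm hs1 hs2]
  exact (summable_norm_sum_mul_antidiagonal_of_summable_norm hs1 hs2).of_norm.hasSum

/-- Uniqueness: the Taylor remainders tend to zero, so a bounded solution is the exponential series
applied to its initial value. -/
theorem heat_eq_tsum {d : ℕ} (hd : 1 ≤ d) (u : ℝ → Site d → ℝ) (u₀ : Site d → ℝ)
    (hmeas : ∀ x, Measurable fun s => u s x) (hbd : ∀ s x, |u s x| ≤ 1)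
    (hu₀ : ∀ x, |u₀ x| ≤ 1)
    (heq : ∀ t, 0 ≤ t → ∀ x, u t x = u₀ x + ∫ s in (0 : ℝ)..t, (latticeStepReal d - 1) (u s) x)
    (t : ℝ) (ht : 0 ≤ t) (x : Site d) :
    u t x = (∑' m : ℕ, t ^ m / (m.factorial : ℝ) * (latticeStepReal d ^ m) u₀ x) *
      Real.exp (-t) := by
  refine tendsto_nhds_unique ?_ (hasSum_latticeLaplacian_exp hd hu₀ t x).tendsto_sum_nat
  have h := squeeze_zero_norm (f := fun n => u t x - ∑ m ∈ Finset.range n,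
    t ^ m / (m.factorial : ℝ) * ((latticeStepReal d - 1) ^ m) u₀ x)
    (fun n => abs_heat_sub_taylor_le hd u u₀ hmeas hbd heq n t ht x)
    (FloorSemiring.tendsto_pow_div_factorial_atTop (2 * t))
  have h2 := (tendsto_const_nhds (x := u t x)).sub h
  simpa using h2

/-! ### From the martingale problem to the heat equation. -/

theorem tendsto_ceil_mul_div_right (s : ℝ≥0) :
    Tendsto (fun n : ℕ => (⌈((n : ℝ≥0) + 1) * s⌉₊ : ℝ≥0) / ((n : ℝ≥0) + 1)) atTop
      (𝓝[Ici s] s) := by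
  refine tendsto_nhdsWithin_iff.2 ⟨?_, ?_⟩
  · have hcomp : Tendsto (fun n : ℕ => (n : ℝ) + 1) atTop atTop :=
      tendsto_atTop_add_const_right _ _ tendsto_natCast_atTop_atTop
    have h := (tendsto_nat_ceil_mul_div_atTop (R := ℝ) (a := (s : ℝ)) s.2).comp hcomp
    rw [← NNReal.tendsto_coe]
    refine h.congr fun n => ?_
    have hc : ⌈((n : ℝ≥0) + 1) * s⌉₊ = ⌈(s : ℝ) * ((n : ℝ) + 1)⌉₊ := by
      refine eq_of_forall_ge_iff fun m => ?_
      rw [Nat.ceil_le, Nat.ceil_le, mul_comm]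
      exact_mod_cast Iff.rfl
    rw [hc]
    push_cast
    rfl
  · refine Eventually.of_forall fun n => ?_
    rw [mem_Ici, le_div_iff₀ (by positivity), mul_comm]
    exact Nat.le_ceil _

/-- Rounding time up to a grid gives jointly measurable approximations, which converge by right
continuity. Joint measurability is needed to exchange the time integral and the expectation. -/
theorem measurable_occ_process {d : ℕ} {Ω : Type*} [MeasurableSpace Ω] {P : Measure Ω}
    {η : ℝ≥0 → Ω → Config d} {η₀ : Config d} (hη : IsExclusionProcess d P η η₀) (x : Site d) :
    Measurable fun p : ℝ × Ω => occ (η p.1.toNNReal p.2) x := by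
  have hstep : ∀ (c : ℝ → ℕ) (r : ℝ≥0), Measurable c →
      Measurable fun p : ℝ × Ω => occ (η (c p.1 / r) p.2) x := by
    intro c r hc
    have h1 : Measurable fun q : ℕ × Ω => occ (η (q.1 / r) q.2) x :=
      measurable_from_prod_countable_right fun k => (measurable_occ x).comp (hη.measurable (k / r))
    exact h1.comp ((hc.comp measurable_fst).prodMk measurable_snd)
  have hdis : ∀ n : ℕ, Measurable fun p : ℝ × Ω =>
      occ (η (⌈((n : ℝ≥0) + 1) * p.1.toNNReal⌉₊ / ((n : ℝ≥0) + 1)) p.2) x := fun n =>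
    hstep (fun s => ⌈((n : ℝ≥0) + 1) * s.toNNReal⌉₊) _ (by fun_prop)
  refine measurable_of_tendsto_metrizable hdis (tendsto_pi_nhds.2 fun p => ?_)
  exact (continuous_occ x).continuousAt.tendsto.comp
    ((hη.right_cont p.2 p.1.toNNReal).tendsto.comp (tendsto_ceil_mul_div_right p.1.toNNReal))

/-- The density of the exclusion process solves the heat equation. -/
theorem integral_occ_eq {d : ℕ} (hd : 1 ≤ d) {Ω : Type*} [MeasurableSpace Ω] {P : Measure Ω}
    [IsProbabilityMeasure P] {η : ℝ≥0 → Ω → Config d} {η₀ : Config d}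
    (hη : IsExclusionProcess d P η η₀) (t : ℝ) (ht : 0 ≤ t) (x : Site d) :
    ∫ ω, occ (η t.toNNReal ω) x ∂P = occ η₀ x + ∫ s in (0 : ℝ)..t,
      (latticeStepReal d - 1) (fun y => ∫ ω, occ (η s.toNNReal ω) y ∂P) x := by
  have hi : ∀ s y, Integrable (fun ω => occ (η s ω) y) P := fun s y =>
    Integrable.of_bound ((measurable_occ y).comp (hη.measurable s)).aestronglyMeasurable 1
      (ae_of_all _ fun ω => abs_occ_le_one _ _)
  have hM := hη.martingale (fun η => occ η x) {x} (by
    intro a b hab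
    have : a x = b x := hab x (by simp)
    simp only [occ, this])
  -- The martingale vanishes at time zero, so its mean is zero at time `t`.
  have h0 := hM.setIntegral_eq (zero_le (a := t.toNNReal)) MeasurableSet.univ
  simp only [Measure.restrict_univ, sub_self, NNReal.coe_zero, intervalIntegral.integral_same,
    integral_zero, exclusionGenerator_occ hd, Real.coe_toNNReal t ht] at h0
  have hjoint : Measurable fun p : ℝ × Ω =>
      (latticeStepReal d - 1) (occ (η p.1.toNNReal p.2)) x := by
    have := fun y => measurable_occ_process hη y
    simp only [LinearMap.sub_apply, Pi.sub_apply, Module.End.one_apply, latticeStepReal_apply,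
      nbrSum]
    fun_prop
  have hjint : Integrable (Function.uncurry fun (ω : Ω) (s : ℝ) =>
      (latticeStepReal d - 1) (occ (η s.toNNReal ω)) x) (P.prod (volume.restrict (Ioc 0 t))) :=
    Integrable.of_bound (hjoint.comp measurable_swap).aestronglyMeasurable (2 * 1)
      (ae_of_all _ fun p => abs_latticeLaplacian_le hd (abs_occ_le_one _) x)
  have hswap : ∫ ω, (∫ s in (0 : ℝ)..t, (latticeStepReal d - 1) (occ (η s.toNNReal ω)) x) ∂P =
      ∫ s in (0 : ℝ)..t,
        (latticeStepReal d - 1) (fun y => ∫ ω, occ (η s.toNNReal ω) y ∂P) x := by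
    simp_rw [intervalIntegral.integral_of_le ht]
    rw [integral_integral_swap hjint]
    refine integral_congr_ae (ae_of_all _ fun s => ?_)
    simp only [LinearMap.sub_apply, Pi.sub_apply, Module.End.one_apply, latticeStepReal_apply,
      nbrSum]
    rw [integral_sub ((integrable_finsetSum _ fun i _ => integrable_finsetSum _ fun k _ =>
      hi _ _).const_mul _) (hi _ _), integral_const_mul,
      integral_finsetSum _ fun i _ => integrable_finsetSum _ fun k _ => hi _ _]
    simp_rw [fun i : Fin d => integral_finsetSum (μ := P) ({1, -1} : Finset ℤ)
      (f := fun k ω => occ (η s.toNNReal ω) (x + Pi.single i k)) fun k _ => hi _ _]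
  have hinit : ∫ ω, occ (η 0 ω) x ∂P = occ η₀ x := by
    rw [integral_congr_ae (g := fun _ => occ η₀ x)
      (hη.initial.mono fun ω hω => by simp only [hω])]
    simp
  have hint : Integrable (fun ω => ∫ s in (0 : ℝ)..t,
      (latticeStepReal d - 1) (occ (η s.toNNReal ω)) x) P := by
    simp_rw [intervalIntegral.integral_of_le ht]
    exact hjint.integral_prod_left
  have hdiff : Integrable (fun ω => occ (η t.toNNReal ω) x - occ (η 0 ω) x) P :=
    (hi _ _).sub (hi _ _)
  rw [integral_sub hdiff hint, hswap, integral_sub (hi _ _) (hi _ _), hinit] at h0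
  linarith

/-- The density of the exclusion process is that of independent random walks. -/
theorem lintegral_occ_eq {d : ℕ} (hd : 1 ≤ d) {Ω : Type*} [MeasurableSpace Ω] {P : Measure Ω}
    [IsProbabilityMeasure P] {η : ℝ≥0 → Ω → Config d} {η₀ : Config d}
    (hη : IsExclusionProcess d P η η₀) (t : ℝ≥0) (x : Site d) :
    ∫⁻ ω, ENNReal.ofReal (occ (η t ω) x) ∂P = ∑' m, poissonWeight t m *
      (latticeStep d ^ m) (fun y => ENNReal.ofReal (occ η₀ y)) x := by
  have hi : Integrable (fun ω => occ (η t ω) x) P :=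
    Integrable.of_bound ((measurable_occ x).comp (hη.measurable t)).aestronglyMeasurable 1
      (ae_of_all _ fun ω => abs_occ_le_one _ _)
  have hbd : ∀ (s : ℝ) (y : Site d), |∫ ω, occ (η s.toNNReal ω) y ∂P| ≤ 1 := by
    intro s y
    have := norm_integral_le_of_norm_le_const (μ := P) (f := fun ω => occ (η s.toNNReal ω) y)
      (C := 1) (ae_of_all _ fun ω => abs_occ_le_one _ _)
    simpa using this
  have h := heat_eq_tsum hd (fun s y => ∫ ω, occ (η s.toNNReal ω) y ∂P) (occ η₀)
    (fun y => ((measurable_occ_process hη y).stronglyMeasurable.integral_prod_right).measurable)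
    hbd (abs_occ_le_one _) (fun t ht x => integral_occ_eq hd hη t ht x) t t.2 x
  rw [Real.toNNReal_coe] at h
  rw [← ofReal_integral_eq_lintegral_ofReal hi (ae_of_all _ fun ω => occ_nonneg _ _), h,
    mul_comm, ← tsum_mul_left]
  have hnn := fun m => latticeStepReal_pow_nonneg (occ_nonneg η₀) m x
  rw [ENNReal.ofReal_tsum_of_nonneg]
  · refine tsum_congr fun m => ?_
    rw [← ofReal_latticeStepReal_pow hd (occ_nonneg η₀), poissonWeight,
      ← ENNReal.ofReal_mul (by positivity)]
    congr 1
    ring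
  · intro m
    have := hnn m
    positivity
  · refine Summable.mul_left _ (Summable.of_nonneg_of_le (fun m => ?_) (fun m => ?_)
      (Real.summable_pow_div_factorial t))
    · have := hnn m
      positivity
    · exact mul_le_of_le_one_right (by positivity)
        ((le_abs_self _).trans (abs_latticeStepReal_pow_le hd (abs_occ_le_one η₀) m x))

/-! ### Counting the particles of the initial profile -/

/-- The number of particles of the initial profile with first coordinate `-u`. -/
noncomputable def layerCount {n : ℕ} (g : Fin n → ℝ → ℝ) (u : ℝ) : ℝ := ∏ i, (2 * (⌊g i u⌋ : ℝ) + 1)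

theorem tsum_occ_shapeProfile_cons {n : ℕ} (g : Fin n → ℝ → ℝ)
    (hg : ∀ i, ∀ u, 0 ≤ u → 0 ≤ g i u) (m : ℤ) :
    ∑' y : Fin n → ℤ, ENNReal.ofReal (occ (shapeProfile g) (Fin.cons m y)) =
      if m ≤ 0 then ENNReal.ofReal (layerCount g (-(m : ℝ))) else 0 := by
  have hocc : ∀ y : Fin n → ℤ, occ (shapeProfile g) (Fin.cons m y) =
      if m ≤ 0 ∧ ∀ i, |(y i : ℝ)| ≤ g i (-(m : ℝ)) then 1 else 0 := by
    intro y
    simp [occ, shapeProfile]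
  simp_rw [hocc]
  split_ifs with hm
  · have hu : (0 : ℝ) ≤ -(m : ℝ) := by
      have : (m : ℝ) ≤ 0 := by exact_mod_cast hm
      linarith
    have hmem : ∀ y : Fin n → ℤ, (∀ i, |(y i : ℝ)| ≤ g i (-(m : ℝ))) ↔
        y ∈ Fintype.piFinset fun i => Finset.Icc (-⌊g i (-(m : ℝ))⌋) ⌊g i (-(m : ℝ))⌋ := by
      intro y
      simp only [Fintype.mem_piFinset, Finset.mem_Icc]
      refine forall_congr' fun i => ?_
      rw [← abs_le, Int.le_floor, Int.cast_abs]
    simp only [hm, true_and, hmem]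
    rw [tsum_eq_sum (s := Fintype.piFinset fun i =>
      Finset.Icc (-⌊g i (-(m : ℝ))⌋) ⌊g i (-(m : ℝ))⌋) (fun y hy => by simp [hy])]
    rw [Finset.sum_congr rfl (g := fun _ => (1 : ℝ≥0∞)) (fun y hy => by rw [if_pos hy]; simp),
      Finset.sum_const, Fintype.card_piFinset, nsmul_eq_mul, mul_one, layerCount,
      ← ENNReal.ofReal_natCast]
    congr 1
    push_cast
    refine Finset.prod_congr rfl fun i _ => ?_
    have h0 : 0 ≤ ⌊g i (-(m : ℝ))⌋ := Int.floor_nonneg.2 (hg i _ hu)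
    rw [Int.card_Icc]
    have : (((⌊g i (-(m : ℝ))⌋ + 1 - -⌊g i (-(m : ℝ))⌋).toNat : ℕ) : ℤ) =
        2 * ⌊g i (-(m : ℝ))⌋ + 1 := by
      rw [Int.toNat_of_nonneg (by omega)]
      ring
    exact_mod_cast congrArg (fun a : ℤ => (a : ℝ)) this
  · simp [hm]

/-- The number of particles of the initial profile with first coordinate larger than `-w`. -/
noncomputable def profileCount {n : ℕ} (g : Fin n → ℝ → ℝ) (w : ℝ) : ℝ≥0∞ :=
  ∑' j : ℕ, if (j : ℝ) < w then ENNReal.ofReal (layerCount g j) else 0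

theorem tsum_shapeProfile_eq_profileCount {n : ℕ} (g : Fin n → ℝ → ℝ)
    (hg : ∀ i, ∀ u, 0 ≤ u → 0 ≤ g i u) (z : ℝ) (k : ℤ) :
    ∑' x : Site (n + 1), (if z < ((x 0 + k : ℤ) : ℝ) then 1 else 0) *
      ENNReal.ofReal (occ (shapeProfile g) x) = profileCount g (k - z) := by
  rw [← (Fin.consEquiv fun _ : Fin (n + 1) => ℤ).tsum_eq, ENNReal.tsum_prod']
  have hcons : ∀ (a : ℤ) (b : Fin n → ℤ),
      (Fin.consEquiv fun _ : Fin (n + 1) => ℤ) (a, b) = Fin.cons a b := fun _ _ => rfl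
  simp only [hcons, Fin.cons_zero]
  simp_rw [ENNReal.tsum_mul_left, tsum_occ_shapeProfile_cons g hg]
  -- Only the layers with nonpositive first coordinate are occupied, so the sum is reindexed by `j =
  -- -m`.
  have hinj : Function.Injective fun j : ℕ => -(j : ℤ) := fun a b h => by simpa using h
  rw [← hinj.tsum_eq]
  · refine tsum_congr fun j => ?_
    have h1 : z < ((-(j : ℤ) + k : ℤ) : ℝ) ↔ (j : ℝ) < k - z := by
      push_cast
      constructor <;> intro h <;> linarith
    have h2 : -(j : ℤ) ≤ 0 := by omega
    have h3 : -((-(j : ℤ) : ℤ) : ℝ) = j := by push_cast; ring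
    simp only [h1, h2, h3, if_true, ite_mul, one_mul, zero_mul]
  · intro m hm
    by_contra hr
    refine hm ?_
    have : ¬ m ≤ 0 := fun h => hr ⟨m.natAbs, by
      change -((m.natAbs : ℕ) : ℤ) = m
      omega⟩
    simp [this]

/-- The expected number of particles beyond `z` is expressed in terms of the one-dimensional
random walk. -/
theorem lintegral_numBeyond {n : ℕ} (g : Fin n → ℝ → ℝ) (hg : ∀ i, ∀ u, 0 ≤ u → 0 ≤ g i u)
    {Ω : Type*} [MeasurableSpace Ω] {P : Measure Ω} [IsProbabilityMeasure P]
    {η : ℝ≥0 → Ω → Config (n + 1)} (hη : IsExclusionProcess (n + 1) P η (shapeProfile g))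
    (z : ℝ) (t : ℝ≥0) :
    ∫⁻ ω, numBeyond (η t ω) z ∂P =
      ∫⁻ k : ℤ, profileCount g (k - z) ∂(srwLaw (t / ((n + 1 : ℕ) : ℝ≥0))) := by
  have hm : ∀ x, Measurable fun ω => ENNReal.ofReal (occ (η t ω) x) := fun x =>
    ((measurable_occ x).comp (hη.measurable t)).ennreal_ofReal
  simp_rw [numBeyond]
  rw [lintegral_tsum fun x : {x : Site (n + 1) // z < (x 0 : ℝ)} => (hm x.1).aemeasurable]
  simp_rw [lintegral_occ_eq (Nat.le_add_left 1 n) hη]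
  refine (tsum_subtype {x : Site (n + 1) | z < (x 0 : ℝ)} fun x => ∑' m, poissonWeight t m *
      (latticeStep (n + 1) ^ m) (fun y => ENNReal.ofReal (occ (shapeProfile g) y)) x).trans ?_
  have h := tsum_mul_poisson_latticeStep n t (fun k : ℤ => if z < (k : ℝ) then 1 else 0)
    fun y => ENNReal.ofReal (occ (shapeProfile g) y)
  simp_rw [← tsum_shapeProfile_eq_profileCount g hg]
  rw [lintegral_tsum fun x => (measurable_of_countable _).aemeasurable]
  simp_rw [lintegral_mul_const _ (measurable_of_countable _)]
  rw [← h]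
  refine tsum_congr fun x => ?_
  by_cases hx : z < (x 0 : ℝ) <;> simp [hx]

/-! ### Comparison of the layer sums with integrals -/

/-- The integrand of `hatG`. -/
noncomputable def faceG {n : ℕ} (g : Fin n → ℝ → ℝ) (A : Finset (Fin n)) (u : ℝ) : ℝ :=
  ∑ i ∈ A, ∏ l ∈ A.erase i, (2 * g l u + 1)

theorem hatG_eq {n : ℕ} (g : Fin n → ℝ → ℝ) (A : Finset (Fin n)) (u : ℝ) :
    hatG g A u = ∫ v in (0 : ℝ)..u, faceG g A v := rfl

section Bounds

variable {n : ℕ} {g : Fin n → ℝ → ℝ}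

theorem one_le_bigG (hg : ∀ i, ∀ u, 0 ≤ u → 0 ≤ g i u) (A : Finset (Fin n)) {u : ℝ} (hu : 0 ≤ u) :
    1 ≤ bigG g A u := by
  rw [← Finset.prod_const_one (s := A)]
  exact Finset.prod_le_prod (fun _ _ => zero_le_one) fun i _ => by linarith [hg i u hu]

theorem monotoneOn_bigG (hg : ∀ i, ∀ u, 0 ≤ u → 0 ≤ g i u) (hm : ∀ i, MonotoneOn (g i) (Ici 0))
    (A : Finset (Fin n)) : MonotoneOn (bigG g A) (Ici 0) := by
  intro u hu v hv huv
  refine Finset.prod_le_prod (fun i _ => by linarith [hg i u hu]) fun i _ => ?_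
  linarith [hm i hu hv huv]

theorem faceG_nonneg (hg : ∀ i, ∀ u, 0 ≤ u → 0 ≤ g i u) (A : Finset (Fin n)) {u : ℝ}
    (hu : 0 ≤ u) : 0 ≤ faceG g A u :=
  Finset.sum_nonneg fun i _ => zero_le_one.trans (one_le_bigG hg (A.erase i) hu)

theorem monotoneOn_faceG (hg : ∀ i, ∀ u, 0 ≤ u → 0 ≤ g i u) (hm : ∀ i, MonotoneOn (g i) (Ici 0))
    (A : Finset (Fin n)) : MonotoneOn (faceG g A) (Ici 0) := fun _ hu _ hv huv =>
  Finset.sum_le_sum fun i _ => monotoneOn_bigG hg hm (A.erase i) hu hv huv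

theorem faceG_le (hg : ∀ i, ∀ u, 0 ≤ u → 0 ≤ g i u) (A : Finset (Fin n)) {u : ℝ} (hu : 0 ≤ u) :
    faceG g A u ≤ n * bigG g A u := by
  have h1 : faceG g A u ≤ ∑ _i ∈ A, bigG g A u := by
    refine Finset.sum_le_sum fun i hi => ?_
    have h0 := one_le_bigG hg (A.erase i) hu
    rw [bigG] at h0
    rw [bigG, ← Finset.mul_prod_erase A _ hi]
    nlinarith [hg i u hu]
  rw [Finset.sum_const, nsmul_eq_mul] at h1
  refine h1.trans ?_
  have h2 : (A.card : ℝ) ≤ n := by exact_mod_cast (Finset.card_le_univ A).trans_eq (by simp)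
  exact mul_le_mul_of_nonneg_right h2 (zero_le_one.trans (one_le_bigG hg A hu))

end Bounds

theorem intervalIntegrable_of_monotoneOn_Ici {h : ℝ → ℝ} (hm : MonotoneOn h (Ici 0)) {a b : ℝ}
    (ha : 0 ≤ a) (hb : 0 ≤ b) : IntervalIntegrable h volume a b :=
  (hm.mono fun _ hx => (le_min ha hb).trans hx.1).intervalIntegrable

/-- The natural numbers `j < w` are those below `⌈w⌉₊`. All terms but the last are compared with
unit intervals inside $[0,w]$, and the last is at most `h w`. -/
theorem sum_le_integral_add {h : ℝ → ℝ} (hm : MonotoneOn h (Ici 0)) (h0 : ∀ u, 0 ≤ u → 0 ≤ h u)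
    {w : ℝ} (hw : 0 < w) :
    ∑ j ∈ Finset.range ⌈w⌉₊, h j ≤ (∫ u in (0 : ℝ)..w, h u) + h w := by
  obtain ⟨M, hM⟩ : ∃ M, ⌈w⌉₊ = M + 1 := Nat.exists_eq_succ_of_ne_zero (Nat.ceil_pos.2 hw).ne'
  have hMw : (M : ℝ) ≤ w := (Nat.lt_ceil.1 (by omega)).le
  have hM0 : (0 : ℝ) ≤ M := Nat.cast_nonneg M
  have h1 := MonotoneOn.sum_le_integral (x₀ := 0) (a := M) (f := h)
    (hm.mono fun _ hx => hx.1)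
  simp only [zero_add] at h1
  have h2 : ∫ u in (0 : ℝ)..M, h u ≤ ∫ u in (0 : ℝ)..w, h u := by
    rw [← intervalIntegral.integral_add_adjacent_intervals
      (intervalIntegrable_of_monotoneOn_Ici hm le_rfl hM0)
      (intervalIntegrable_of_monotoneOn_Ici hm hM0 hw.le)]
    have := intervalIntegral.integral_nonneg (μ := volume) hMw fun u hu => h0 u (hM0.trans hu.1)
    linarith
  rw [hM, Finset.sum_range_succ]
  exact add_le_add (h1.trans h2) (hm hM0 hw.le hMw)

theorem integral_le_sum_add {h : ℝ → ℝ} (hm : MonotoneOn h (Ici 0)) (h0 : ∀ u, 0 ≤ u → 0 ≤ h u)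
    {w : ℝ} (hw : 0 < w) :
    ∫ u in (0 : ℝ)..w, h u ≤ ∑ j ∈ Finset.range ⌈w⌉₊, h j + h w := by
  obtain ⟨M, hM⟩ : ∃ M, ⌈w⌉₊ = M + 1 := Nat.exists_eq_succ_of_ne_zero (Nat.ceil_pos.2 hw).ne'
  have hMw : (M : ℝ) ≤ w := (Nat.lt_ceil.1 (by omega)).le
  have hwM : w ≤ M + 1 := by
    have := Nat.le_ceil w
    rw [hM] at this
    exact_mod_cast this
  have hM0 : (0 : ℝ) ≤ M := Nat.cast_nonneg M
  have h1 := MonotoneOn.integral_le_sum (x₀ := 0) (a := M) (f := h)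
    (hm.mono fun _ hx => hx.1)
  simp only [zero_add] at h1
  have h2 : ∫ u in (M : ℝ)..w, h u ≤ h w := by
    have h3 : ∫ u in (M : ℝ)..w, h u ≤ ∫ _u in (M : ℝ)..w, h w :=
      intervalIntegral.integral_mono_on hMw (intervalIntegrable_of_monotoneOn_Ici hm hM0 hw.le)
        intervalIntegrable_const fun u hu => hm (hM0.trans hu.1) hw.le hu.2
    rw [intervalIntegral.integral_const, smul_eq_mul] at h3
    nlinarith [h0 w hw.le]
  rw [← intervalIntegral.integral_add_adjacent_intervals
    (intervalIntegrable_of_monotoneOn_Ici hm le_rfl hM0)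
    (intervalIntegrable_of_monotoneOn_Ici hm hM0 hw.le), hM, Finset.sum_range_succ']
  have h4 := h0 0 le_rfl
  push_cast at h1 ⊢
  linarith

/-- Lower the factors from `a` to `b` one at a time; each change costs the difference times the
other factors, each of which is at most its value under `a`. -/
theorem prod_le_prod_add_sum {ι : Type*} [DecidableEq ι] (s : Finset ι) (a b : ι → ℝ)
    (hb : ∀ i ∈ s, 0 ≤ b i) (hab : ∀ i ∈ s, b i ≤ a i) :
    ∏ i ∈ s, a i ≤ ∏ i ∈ s, b i + ∑ i ∈ s, (a i - b i) * ∏ l ∈ s.erase i, a l := by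
  induction s using Finset.induction_on with
  | empty => simp
  | insert k s hk ih =>
    have hbk := hb k (Finset.mem_insert_self k s)
    have habk := hab k (Finset.mem_insert_self k s)
    have hbs : ∀ i ∈ s, 0 ≤ b i := fun i hi => hb i (Finset.mem_insert_of_mem hi)
    have habs : ∀ i ∈ s, b i ≤ a i := fun i hi => hab i (Finset.mem_insert_of_mem hi)
    have ih' := mul_le_mul_of_nonneg_left (ih hbs habs) hbk
    rw [Finset.prod_insert hk, Finset.prod_insert hk, Finset.sum_insert hk,
      Finset.erase_insert hk]
    have h1 : b k * ∑ i ∈ s, (a i - b i) * ∏ l ∈ s.erase i, a l ≤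
        ∑ i ∈ s, (a i - b i) * ∏ l ∈ (insert k s).erase i, a l := by
      rw [Finset.mul_sum]
      refine Finset.sum_le_sum fun i hi => ?_
      have hne : k ≠ i := fun h => hk (h ▸ hi)
      rw [Finset.erase_insert_of_ne hne,
        Finset.prod_insert fun h => hk (Finset.mem_of_mem_erase h)]
      have h2 : 0 ≤ (a i - b i) * ∏ l ∈ s.erase i, a l :=
        mul_nonneg (sub_nonneg.2 (habs i hi)) (Finset.prod_nonneg fun l hl =>
          (hbs l (Finset.mem_of_mem_erase hl)).trans (habs l (Finset.mem_of_mem_erase hl)))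
      nlinarith
    linarith

/-- The floors are integers bounded above, so they attain a greatest value, and by monotonicity they
keep it. -/
theorem exists_floor_limit {h : ℝ → ℝ} (hm : MonotoneOn h (Ici 0)) (hb : BddAbove (h '' Ici 0)) :
    ∃ (c : ℤ) (u₀ : ℝ), 0 ≤ u₀ ∧ (∀ u, 0 ≤ u → ⌊h u⌋ ≤ c) ∧ ∀ u, u₀ ≤ u → ⌊h u⌋ = c := by
  obtain ⟨M, hM⟩ := hb
  obtain ⟨c, ⟨u₀, hu₀, hc⟩, hmax⟩ := Int.exists_greatest_of_bdd
    (P := fun c => ∃ u, 0 ≤ u ∧ ⌊h u⌋ = c)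
    ⟨⌊M⌋, by
      rintro _ ⟨u, hu, rfl⟩
      exact Int.floor_le_floor (hM ⟨u, hu, rfl⟩)⟩ ⟨_, 0, le_rfl, rfl⟩
  refine ⟨c, u₀, hu₀, fun u hu => hmax _ ⟨u, hu, rfl⟩, fun u hu => ?_⟩
  refine le_antisymm (hmax _ ⟨u, hu₀.trans hu, rfl⟩) ?_
  rw [← hc]
  exact Int.floor_le_floor (hm hu₀ (hu₀.trans hu) hu)

theorem bddAbove_of_mem_compl_unboundedIdx {n : ℕ} {g : Fin n → ℝ → ℝ} {i : Fin n}
    (hi : i ∈ (unboundedIdx g)ᶜ) : BddAbove (g i '' Ici 0) := by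
  simpa [unboundedIdx] using hi

theorem exists_layer_limits {n : ℕ} {g : Fin n → ℝ → ℝ} (hm : ∀ i, MonotoneOn (g i) (Ici 0)) :
    ∃ (L : Fin n → ℝ) (u₀ : ℝ), ∀ i ∈ (unboundedIdx g)ᶜ,
      (∀ u, 0 ≤ u → 2 * (⌊g i u⌋ : ℝ) + 1 ≤ L i) ∧ ∀ u, u₀ ≤ u → 2 * (⌊g i u⌋ : ℝ) + 1 = L i := by
  have h : ∀ i, ∃ (l : ℝ) (v : ℝ), 0 ≤ v ∧ (i ∈ (unboundedIdx g)ᶜ →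
      (∀ u, 0 ≤ u → 2 * (⌊g i u⌋ : ℝ) + 1 ≤ l) ∧
        ∀ u, v ≤ u → 2 * (⌊g i u⌋ : ℝ) + 1 = l) := by
    intro i
    by_cases hi : i ∈ (unboundedIdx g)ᶜ
    · obtain ⟨c, v, hv, h1, h2⟩ :=
        exists_floor_limit (hm i) (bddAbove_of_mem_compl_unboundedIdx hi)
      refine ⟨2 * (c : ℝ) + 1, v, hv, fun _ => ⟨fun u hu => ?_, fun u hu => by rw [h2 u hu]⟩⟩
      have : (⌊g i u⌋ : ℝ) ≤ c := by exact_mod_cast h1 u hu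
      linarith
    · exact ⟨0, 0, le_rfl, fun h => absurd h hi⟩
  choose L v hv hL using h
  -- The sum of the nonnegative individual thresholds serves as a common threshold.
  refine ⟨L, ∑ i, v i, fun i hi => ⟨(hL i hi).1, fun u hu => (hL i hi).2 u (le_trans ?_ hu)⟩⟩
  exact Finset.single_le_sum (fun j _ => hv j) (Finset.mem_univ i)

section Compare

variable {n : ℕ} {g : Fin n → ℝ → ℝ} {L : Fin n → ℝ} {u₀ : ℝ}

theorem one_le_floor_factor (hg : ∀ i, ∀ u, 0 ≤ u → 0 ≤ g i u) (i : Fin n) {u : ℝ}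
    (hu : 0 ≤ u) : 1 ≤ 2 * (⌊g i u⌋ : ℝ) + 1 := by
  have : (0 : ℝ) ≤ ⌊g i u⌋ := by exact_mod_cast Int.floor_nonneg.2 (hg i u hu)
  linarith

theorem one_le_prod_limits (hg : ∀ i, ∀ u, 0 ≤ u → 0 ≤ g i u)
    (hL : ∀ i ∈ (unboundedIdx g)ᶜ, ∀ u, 0 ≤ u → 2 * (⌊g i u⌋ : ℝ) + 1 ≤ L i) :
    1 ≤ ∏ i ∈ (unboundedIdx g)ᶜ, L i := by
  rw [← Finset.prod_const_one (s := (unboundedIdx g)ᶜ)]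
  exact Finset.prod_le_prod (fun _ _ => zero_le_one) fun i hi =>
    (one_le_floor_factor hg i le_rfl).trans (hL i hi 0 le_rfl)

theorem layerCount_nonneg (hg : ∀ i, ∀ u, 0 ≤ u → 0 ≤ g i u) {u : ℝ} (hu : 0 ≤ u) :
    0 ≤ layerCount g u :=
  Finset.prod_nonneg fun i _ => zero_le_one.trans (one_le_floor_factor hg i hu)

theorem layerCount_le (hg : ∀ i, ∀ u, 0 ≤ u → 0 ≤ g i u)
    (hL : ∀ i ∈ (unboundedIdx g)ᶜ, ∀ u, 0 ≤ u → 2 * (⌊g i u⌋ : ℝ) + 1 ≤ L i) {u : ℝ}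
    (hu : 0 ≤ u) :
    layerCount g u ≤ (∏ i ∈ (unboundedIdx g)ᶜ, L i) * bigG g (unboundedIdx g) u := by
  rw [layerCount, ← Finset.prod_compl_mul_prod (unboundedIdx g)]
  have h1 := fun i => zero_le_one.trans (one_le_floor_factor hg i hu)
  refine mul_le_mul (Finset.prod_le_prod (fun i _ => h1 i) fun i hi => hL i hi u hu)
    (Finset.prod_le_prod (fun i _ => h1 i) fun i _ => ?_) (Finset.prod_nonneg fun i _ => h1 i)
    (zero_le_one.trans (one_le_prod_limits hg hL))
  linarith [Int.floor_le (g i u)]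

/-- Beyond `u₀` the bounded factors are exact, so only the unbounded ones lose anything, each less
than $2$. -/
theorem le_layerCount_add (hg : ∀ i, ∀ u, 0 ≤ u → 0 ≤ g i u)
    (hL : ∀ i ∈ (unboundedIdx g)ᶜ, ∀ u, 0 ≤ u → 2 * (⌊g i u⌋ : ℝ) + 1 ≤ L i)
    (hL' : ∀ i ∈ (unboundedIdx g)ᶜ, ∀ u, u₀ ≤ u → 2 * (⌊g i u⌋ : ℝ) + 1 = L i) {u : ℝ}
    (hu : 0 ≤ u) (huu : u₀ ≤ u) :
    (∏ i ∈ (unboundedIdx g)ᶜ, L i) * bigG g (unboundedIdx g) u ≤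
      layerCount g u + 2 * (∏ i ∈ (unboundedIdx g)ᶜ, L i) * faceG g (unboundedIdx g) u := by
  rw [layerCount, ← Finset.prod_compl_mul_prod (unboundedIdx g),
    Finset.prod_congr rfl fun i hi => hL' i hi u huu]
  have h1 := prod_le_prod_add_sum (unboundedIdx g) (fun i => 2 * g i u + 1)
    (fun i => 2 * (⌊g i u⌋ : ℝ) + 1) (fun i _ => zero_le_one.trans (one_le_floor_factor hg i hu))
    fun i _ => by linarith [Int.floor_le (g i u)]
  have h2 : ∑ i ∈ unboundedIdx g, (2 * g i u + 1 - (2 * (⌊g i u⌋ : ℝ) + 1)) *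
      ∏ l ∈ (unboundedIdx g).erase i, (2 * g l u + 1) ≤ 2 * faceG g (unboundedIdx g) u := by
    rw [faceG, Finset.mul_sum]
    refine Finset.sum_le_sum fun i _ => mul_le_mul_of_nonneg_right ?_
      (zero_le_one.trans (one_le_bigG hg ((unboundedIdx g).erase i) hu))
    linarith [Int.lt_floor_add_one (g i u)]
  have h3 := mul_le_mul_of_nonneg_left (h1.trans (add_le_add le_rfl h2))
    (zero_le_one.trans (one_le_prod_limits hg hL))
  refine h3.trans_eq ?_
  ring

theorem sum_layerCount_le (hg : ∀ i, ∀ u, 0 ≤ u → 0 ≤ g i u)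
    (hm : ∀ i, MonotoneOn (g i) (Ici 0))
    (hL : ∀ i ∈ (unboundedIdx g)ᶜ, ∀ u, 0 ≤ u → 2 * (⌊g i u⌋ : ℝ) + 1 ≤ L i)
    {w : ℝ} (hw : 0 < w) :
    ∑ j ∈ Finset.range ⌈w⌉₊, layerCount g j ≤ (∏ i ∈ (unboundedIdx g)ᶜ, L i) *
      ((∫ u in (0 : ℝ)..w, bigG g (unboundedIdx g) u) + bigG g (unboundedIdx g) w) := by
  refine (Finset.sum_le_sum fun j _ => layerCount_le hg hL (Nat.cast_nonneg j)).trans ?_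
  rw [← Finset.mul_sum]
  exact mul_le_mul_of_nonneg_left (sum_le_integral_add (monotoneOn_bigG hg hm _)
    (fun u hu => zero_le_one.trans (one_le_bigG hg _ hu)) hw)
    (zero_le_one.trans (one_le_prod_limits hg hL))

/-- In the constant, `⌈u₀⌉₊` counts the layers before the bounded factors settle, `1` comes from
comparing the integral of $G_U$ with a sum, and `2 * n` from the end term when the sum of `faceG` is
compared with `hatG`. -/
theorem le_sum_layerCount_add (hg : ∀ i, ∀ u, 0 ≤ u → 0 ≤ g i u)
    (hm : ∀ i, MonotoneOn (g i) (Ici 0))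
    (hL : ∀ i ∈ (unboundedIdx g)ᶜ, ∀ u, 0 ≤ u → 2 * (⌊g i u⌋ : ℝ) + 1 ≤ L i)
    (hL' : ∀ i ∈ (unboundedIdx g)ᶜ, ∀ u, u₀ ≤ u → 2 * (⌊g i u⌋ : ℝ) + 1 = L i)
    {w : ℝ} (hw : 0 < w) :
    (∏ i ∈ (unboundedIdx g)ᶜ, L i) * (∫ u in (0 : ℝ)..w, bigG g (unboundedIdx g) u) ≤
      ∑ j ∈ Finset.range ⌈w⌉₊, layerCount g j + (∏ i ∈ (unboundedIdx g)ᶜ, L i) *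
        ((⌈u₀⌉₊ + 2 * n + 1) * bigG g (unboundedIdx g) w + 2 * hatG g (unboundedIdx g) w) := by
  set Λ := ∏ i ∈ (unboundedIdx g)ᶜ, L i with hΛ
  set G := bigG g (unboundedIdx g) with hG
  have hΛ0 : 0 ≤ Λ := zero_le_one.trans (one_le_prod_limits hg hL)
  have hG0 : ∀ u, 0 ≤ u → 0 ≤ G u := fun u hu => zero_le_one.trans (one_le_bigG hg _ hu)
  have hGm : MonotoneOn G (Ici 0) := monotoneOn_bigG hg hm _
  have h1 := integral_le_sum_add hGm hG0 hw
  have h2 := sum_le_integral_add (monotoneOn_faceG hg hm (unboundedIdx g))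
    (fun u hu => faceG_nonneg hg _ hu) hw
  rw [← hatG_eq] at h2
  have h3 := faceG_le hg (unboundedIdx g) hw.le
  have h4 : ∀ j ∈ Finset.range ⌈w⌉₊, Λ * G j ≤ layerCount g j +
      2 * Λ * faceG g (unboundedIdx g) j + if j ∈ Finset.range ⌈u₀⌉₊ then Λ * G w else 0 := by
    intro j hj
    have hjw : (j : ℝ) < w := Nat.lt_ceil.1 (Finset.mem_range.1 hj)
    have hj0 : (0 : ℝ) ≤ j := Nat.cast_nonneg j
    have hf : 0 ≤ 2 * Λ * faceG g (unboundedIdx g) j := by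
      have := faceG_nonneg hg (unboundedIdx g) hj0
      positivity
    split_ifs with hju
    · have := mul_le_mul_of_nonneg_left (hGm hj0 hw.le hjw.le) hΛ0
      linarith [layerCount_nonneg hg hj0]
    · rw [add_zero]
      refine le_layerCount_add hg hL hL' hj0 ?_
      rw [Finset.mem_range, not_lt] at hju
      exact Nat.ceil_le.1 hju
  have h5 := Finset.sum_le_sum h4
  rw [Finset.sum_add_distrib, Finset.sum_add_distrib, ← Finset.mul_sum, ← Finset.mul_sum,
    ← Finset.sum_filter, Finset.sum_const, nsmul_eq_mul] at h5
  have h6 : (((Finset.range ⌈w⌉₊).filter (· ∈ Finset.range ⌈u₀⌉₊)).card : ℝ) ≤ ⌈u₀⌉₊ := by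
    have : ((Finset.range ⌈w⌉₊).filter (· ∈ Finset.range ⌈u₀⌉₊)).card ≤
        (Finset.range ⌈u₀⌉₊).card :=
      Finset.card_le_card fun j hj => (Finset.mem_filter.1 hj).2
    rw [Finset.card_range] at this
    exact_mod_cast this
  have h7 := mul_le_mul_of_nonneg_right h6 (mul_nonneg hΛ0 (hG0 w hw.le))
  have h8 := mul_le_mul_of_nonneg_left h1 hΛ0
  have h9 := mul_le_mul_of_nonneg_left (h2.trans (add_le_add_right h3 _))
    (mul_nonneg zero_le_two hΛ0)
  linarith

end Compare

theorem profileCount_eq {n : ℕ} {g : Fin n → ℝ → ℝ} (hg : ∀ i, ∀ u, 0 ≤ u → 0 ≤ g i u) (w : ℝ) :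
    profileCount g w = ENNReal.ofReal (∑ j ∈ Finset.range ⌈w⌉₊, layerCount g j) := by
  rw [profileCount, tsum_eq_sum (s := Finset.range ⌈w⌉₊),
    ENNReal.ofReal_sum_of_nonneg fun j _ => layerCount_nonneg hg (Nat.cast_nonneg j)]
  · exact Finset.sum_congr rfl fun j hj => if_pos (Nat.lt_ceil.1 (Finset.mem_range.1 hj))
  · intro j hj
    exact if_neg fun h => hj (Finset.mem_range.2 (Nat.lt_ceil.2 h))

/-! ### Finiteness -/

/-- Formally $S\le a_0+S/2+B$, hence $S\le2(a_0+B)$. As $S$ could be infinite, the bound is proved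
for partial sums by induction. -/
theorem tsum_lt_top_of_succ_le {a b : ℕ → ℝ≥0∞} (ha : a 0 < ⊤) (hb : ∑' n, b n < ⊤)
    (h : ∀ n, a (n + 1) ≤ 2⁻¹ * a n + b (n + 1)) : ∑' n, a n < ⊤ := by
  have h2 : (2⁻¹ : ℝ≥0∞) * 2 = 1 := ENNReal.inv_mul_cancel (by simp) (by simp)
  have key : ∀ N, ∑ n ∈ Finset.range N, a n ≤ 2 * (a 0 + ∑' n, b n) := by
    intro N
    induction N with
    | zero => simp
    | succ N ih =>
      rw [Finset.sum_range_succ']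
      calc _ ≤ ∑ n ∈ Finset.range N, (2⁻¹ * a n + b (n + 1)) + a 0 := by
            gcongr with n
            exact h n
        _ = 2⁻¹ * ∑ n ∈ Finset.range N, a n + ∑ n ∈ Finset.range N, b (n + 1) + a 0 := by
            rw [Finset.sum_add_distrib, Finset.mul_sum]
        _ ≤ 2⁻¹ * (2 * (a 0 + ∑' n, b n)) + ∑' n, b n + a 0 := by
            gcongr
            calc ∑ n ∈ Finset.range N, b (n + 1) ≤ ∑ n ∈ Finset.range (N + 1), b n := by
                  rw [Finset.sum_range_succ']
                  exact le_self_add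
              _ ≤ _ := ENNReal.sum_le_tsum _
        _ = _ := by
            rw [← mul_assoc, h2]
            ring
  exact (ENNReal.tsum_le_of_sum_range_le key).trans_lt
    (ENNReal.mul_lt_top (by simp) (ENNReal.add_lt_top.2 ⟨ha, hb⟩))

theorem lintegral_srwLaw_eq_tsum (s : ℝ≥0) (f : ℤ → ℝ≥0∞) :
    ∫⁻ k, f k ∂(srwLaw s) = ∑' k, f k * srwLaw s {k} :=
  lintegral_countable' f

theorem tsum_int_lt_top {F : ℤ → ℝ≥0∞} (hF : ∀ k, F k < ⊤) {a : ℤ} (K : ℕ)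
    (h0 : ∀ k, k ≤ a → F k = 0) (h : ∑' n : ℕ, F ((K + n : ℕ) : ℤ) < ⊤) : ∑' k, F k < ⊤ := by
  have hinj : Function.Injective fun n : ℕ => ((K + n : ℕ) : ℤ) := fun m n h => by
    simpa using h
  have h1 : ∑' k : ℤ, (if (K : ℤ) ≤ k then F k else 0) = ∑' n : ℕ, F ((K + n : ℕ) : ℤ) := by
    rw [← hinj.tsum_eq]
    · exact tsum_congr fun n => by simp
    · intro k hk
      by_contra hr
      refine hk (if_neg fun hle => hr ⟨(k - K).toNat, ?_⟩)
      change ((K + (k - K).toNat : ℕ) : ℤ) = k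
      omega
  have h2 : ∀ k, F k ≤ (if k ∈ Finset.Ioo a (K : ℤ) then F k else 0) +
      if (K : ℤ) ≤ k then F k else 0 := by
    intro k
    by_cases hK : (K : ℤ) ≤ k
    · rw [if_pos hK]
      exact le_add_self
    · by_cases ha : k ≤ a
      · simp [h0 k ha]
      · rw [if_pos (Finset.mem_Ioo.2 ⟨by omega, by omega⟩)]
        exact le_self_add
  refine (ENNReal.tsum_le_tsum h2).trans_lt ?_
  rw [ENNReal.tsum_add, h1, tsum_eq_sum (s := Finset.Ioo a (K : ℤ)) fun k hk => if_neg hk]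
  refine ENNReal.add_lt_top.2 ⟨ENNReal.sum_lt_top.2 fun k hk => ?_, h⟩
  rw [if_pos hk]
  exact hF k

theorem meanBeyond_eq_tsum (h : ℝ → ℝ) (s : ℝ≥0) (z : ℝ) :
    meanBeyond h s z = ∑' k : ℤ, (if z < (k : ℝ) then ENNReal.ofReal (h (k - z)) else 0) *
      srwLaw s {k} := by
  rw [meanBeyond, ← lintegral_indicator (MeasurableSet.of_discrete), lintegral_srwLaw_eq_tsum]
  rfl

theorem integral_le_integral_add {h : ℝ → ℝ} (hm : MonotoneOn h (Ici 0)) {w : ℝ} (hw : 0 ≤ w) :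
    ∫ u in (0 : ℝ)..(w + 1), h u ≤ (∫ u in (0 : ℝ)..w, h u) + h (w + 1) := by
  have hw1 : (0 : ℝ) ≤ w + 1 := by linarith
  rw [← intervalIntegral.integral_add_adjacent_intervals
    (intervalIntegrable_of_monotoneOn_Ici hm le_rfl hw)
    (intervalIntegrable_of_monotoneOn_Ici hm hw hw1)]
  have h3 : ∫ u in w..(w + 1), h u ≤ ∫ _u in w..(w + 1), h (w + 1) :=
    intervalIntegral.integral_mono_on (by linarith) (intervalIntegrable_of_monotoneOn_Ici hm hw hw1)
      intervalIntegrable_const fun u hu => hm (hw.trans hu.1) hw1 hu.2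
  rw [intervalIntegral.integral_const, smul_eq_mul, add_sub_cancel_left, one_mul] at h3
  linarith

/-- Moving one site further adds at most $G_A(w+1)$ to the integral, while the point probability at
least halves. The terms therefore satisfy the recursion of `tsum_lt_top_of_succ_le`, with the
summable terms of `meanBeyond` as inhomogeneity. -/
theorem meanIntG_lt_top {n : ℕ} {g : Fin n → ℝ → ℝ} (hg : ∀ i, ∀ u, 0 ≤ u → 0 ≤ g i u)
    (hm : ∀ i, MonotoneOn (g i) (Ici 0)) (A : Finset (Fin n)) (s : ℝ≥0) (z : ℝ)
    (h : meanBeyond (bigG g A) s z < ⊤) : meanIntG g A s z < ⊤ := by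
  have hGm := monotoneOn_bigG hg hm A
  have hp : ∀ k : ℤ, srwLaw s {k} < ⊤ := fun k => measure_lt_top _ _
  rw [meanBeyond_eq_tsum] at h
  rw [meanIntG, lintegral_srwLaw_eq_tsum]
  set lam : ℝ := ((s * 2⁻¹ : ℝ≥0) : ℝ) with hlam
  -- `K` lies beyond `z`, and also beyond `2 * lam`, so that the ratio `lam / (k + 1)` of successive
  -- point probabilities is at most one half from there on.
  set K : ℕ := ⌈z⌉₊ + ⌈2 * lam⌉₊ + 1 with hK
  have hzK : z < K := by
    have := Nat.le_ceil z
    rw [hK]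
    push_cast
    linarith [(Nat.cast_nonneg ⌈2 * lam⌉₊ : (0 : ℝ) ≤ _)]
  have hlK : 2 * lam ≤ K := by
    have := Nat.le_ceil (2 * lam)
    rw [hK]
    push_cast
    linarith [(Nat.cast_nonneg ⌈z⌉₊ : (0 : ℝ) ≤ _)]
  refine tsum_int_lt_top (fun k => ENNReal.mul_lt_top ENNReal.ofReal_lt_top (hp k)) (a := ⌊z⌋) K
    (fun k hk => ?_) ?_
  · have : (k : ℝ) ≤ z := Int.le_floor.1 hk
    rw [max_eq_right (by linarith)]
    simp
  refine tsum_lt_top_of_succ_le (ENNReal.mul_lt_top ENNReal.ofReal_lt_top (hp _))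
    (b := fun m => (if z < (((K + m : ℕ) : ℤ) : ℝ) then
      ENNReal.ofReal (bigG g A (((K + m : ℕ) : ℤ) - z)) else 0) * srwLaw s {((K + m : ℕ) : ℤ)})
    (lt_of_le_of_lt ?_ h) fun m => ?_
  · exact ENNReal.tsum_comp_le_tsum_of_injective
      (f := fun m : ℕ => ((K + m : ℕ) : ℤ)) (fun m n h => by simpa using h) _
  · have hw : 0 ≤ (((K + m : ℕ) : ℤ) : ℝ) - z := by
      push_cast
      linarith [(Nat.cast_nonneg m : (0 : ℝ) ≤ m)]
    have hcast : (((K + (m + 1) : ℕ) : ℤ) : ℝ) - z = ((((K + m : ℕ) : ℤ) : ℝ) - z) + 1 := by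
      push_cast
      ring
    have hz' : z < (((K + (m + 1) : ℕ) : ℤ) : ℝ) := by linarith
    rw [if_pos hz', hcast, max_eq_left hw, max_eq_left (by linarith)]
    set w := (((K + m : ℕ) : ℤ) : ℝ) - z
    have h1 := ENNReal.ofReal_le_ofReal (integral_le_integral_add hGm hw)
    have h2 : srwLaw s {((K + (m + 1) : ℕ) : ℤ)} ≤ 2⁻¹ * srwLaw s {((K + m : ℕ) : ℤ)} := by
      refine (srwLaw_singleton_succ_le s (K + m)).trans (mul_le_mul_left ?_ _)
      rw [ENNReal.ofReal_le_iff_le_toReal (by simp), ← hlam, div_le_iff₀ (by positivity)]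
      simp only [ENNReal.toReal_inv, ENNReal.toReal_ofNat]
      push_cast
      linarith [(Nat.cast_nonneg m : (0 : ℝ) ≤ m)]
    calc _ ≤ (ENNReal.ofReal (∫ u in (0 : ℝ)..w, bigG g A u) +
          ENNReal.ofReal (bigG g A (w + 1))) * srwLaw s {((K + (m + 1) : ℕ) : ℤ)} := by
          gcongr
          exact h1.trans ENNReal.ofReal_add_le
      _ ≤ ENNReal.ofReal (∫ u in (0 : ℝ)..w, bigG g A u) * (2⁻¹ * srwLaw s {((K + m : ℕ) : ℤ)}) +
          ENNReal.ofReal (bigG g A (w + 1)) * srwLaw s {((K + (m + 1) : ℕ) : ℤ)} := by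
          rw [add_mul]
          gcongr
      _ = _ := by ring

/-! ### The error vanishes in the long run -/

section Subexponential

variable {n : ℕ} {g : Fin n → ℝ → ℝ}

theorem tendsto_atTop_of_mem_unboundedIdx (hm : ∀ i, MonotoneOn (g i) (Ici 0)) {i : Fin n}
    (hi : i ∈ unboundedIdx g) : Tendsto (g i) atTop atTop := by
  have hu : ¬ BddAbove (g i '' Ici 0) := by simpa [unboundedIdx] using hi
  refine tendsto_atTop.2 fun b => ?_
  obtain ⟨_, ⟨u, hu0, rfl⟩, hub⟩ := not_bddAbove_iff.1 hu b
  filter_upwards [eventually_ge_atTop u] with v hv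
  exact hub.le.trans (hm i hu0 (le_trans hu0 hv) hv)

theorem hasDerivAt_of_subexp {h : ℝ → ℝ} (hs : SubexpCondition h) {u : ℝ} (hu : 0 < u) :
    HasDerivAt h (derivWithin h (Ici 0) u) u :=
  ((hs.1.differentiableOn one_ne_zero u hu.le).hasDerivWithinAt).hasDerivAt (Ici_mem_nhds hu)

theorem hasDerivAt_bigG (hs : ∀ i ∈ unboundedIdx g, SubexpCondition (g i)) {u : ℝ} (hu : 0 < u) :
    HasDerivAt (bigG g (unboundedIdx g)) (∑ i ∈ unboundedIdx g,
      (∏ l ∈ (unboundedIdx g).erase i, (2 * g l u + 1)) *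
        (2 * derivWithin (g i) (Ici 0) u)) u :=
  HasDerivAt.fun_finsetProd fun i hi =>
    ((hasDerivAt_of_subexp (hs i hi) hu).const_mul 2).add_const 1

theorem continuousOn_bigG (hc : ∀ i, ContinuousOn (g i) (Ici 0)) (A : Finset (Fin n)) :
    ContinuousOn (bigG g A) (Ici 0) :=
  continuousOn_finsetProd A fun i _ => (continuousOn_const.mul (hc i)).add continuousOn_const

/-- Each of the at most `n` face products lacks one factor of $G_U$, and that factor tends to
infinity. -/
theorem eventually_faceG_le (hg : ∀ i, ∀ u, 0 ≤ u → 0 ≤ g i u)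
    (hm : ∀ i, MonotoneOn (g i) (Ici 0)) {δ : ℝ} (hδ : 0 < δ) :
    ∀ᶠ u in atTop, faceG g (unboundedIdx g) u ≤ δ * bigG g (unboundedIdx g) u := by
  have h1 : ∀ᶠ u in atTop, ∀ i ∈ unboundedIdx g, n / δ ≤ g i u :=
    (Finset.eventually_all _).2 fun i hi =>
      (tendsto_atTop_of_mem_unboundedIdx hm hi).eventually_ge_atTop _
  filter_upwards [h1, eventually_ge_atTop 0] with u hu hu0
  have hG := one_le_bigG hg (unboundedIdx g) hu0
  have h2 : ∀ i ∈ unboundedIdx g, n * ∏ l ∈ (unboundedIdx g).erase i, (2 * g l u + 1) ≤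
      δ * bigG g (unboundedIdx g) u := by
    intro i hi
    have h0 := zero_le_one.trans (one_le_bigG hg ((unboundedIdx g).erase i) hu0)
    rw [bigG] at h0
    rw [bigG, ← Finset.mul_prod_erase _ _ hi, ← mul_assoc]
    refine mul_le_mul_of_nonneg_right ?_ h0
    have h3 := (div_le_iff₀ hδ).1 (hu i hi)
    nlinarith [hg i u hu0]
  have h4 := Finset.sum_le_sum h2
  rw [← Finset.mul_sum, Finset.sum_const, nsmul_eq_mul] at h4
  rcases Nat.eq_zero_or_pos n with rfl | hn
  · have : faceG g (unboundedIdx g) u = 0 := Finset.sum_eq_zero fun i => i.elim0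
    rw [this]
    positivity
  · have hcard : ((unboundedIdx g).card : ℝ) ≤ n := by
      exact_mod_cast (Finset.card_le_univ _).trans_eq (by simp)
    have hn' : (0 : ℝ) < n := by exact_mod_cast hn
    refine le_of_mul_le_mul_left (h4.trans ?_) hn'
    exact mul_le_mul_of_nonneg_right hcard (by positivity)

/-- The logarithmic derivative of $G_U$ is $\sum_{i\in U}2g_i'/(2g_i+1)$, and each summand is
eventually small because $g_i'/g_i\to0$. -/
theorem eventually_deriv_bigG_le (hg : ∀ i, ∀ u, 0 ≤ u → 0 ≤ g i u)
    (hm : ∀ i, MonotoneOn (g i) (Ici 0))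
    (hs : ∀ i ∈ unboundedIdx g, SubexpCondition (g i)) {δ : ℝ} (hδ : 0 < δ) :
    ∀ᶠ u in atTop, ∑ i ∈ unboundedIdx g,
      (∏ l ∈ (unboundedIdx g).erase i, (2 * g l u + 1)) * (2 * derivWithin (g i) (Ici 0) u) ≤
        δ * bigG g (unboundedIdx g) u := by
  have hn : (0 : ℝ) < n + 1 := by positivity
  have h1 : ∀ᶠ u in atTop, ∀ i ∈ unboundedIdx g,
      derivWithin (g i) (Ici 0) u / g i u < δ / (n + 1) ∧ 0 < g i u :=
    (Finset.eventually_all _).2 fun i hi =>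
      ((hs i hi).2.eventually_lt_const (by positivity)).and
        ((tendsto_atTop_of_mem_unboundedIdx hm hi).eventually_gt_atTop 0)
  filter_upwards [h1, eventually_ge_atTop 0] with u hu hu0
  have hG := one_le_bigG hg (unboundedIdx g) hu0
  have h2 : ∀ i ∈ unboundedIdx g, (∏ l ∈ (unboundedIdx g).erase i, (2 * g l u + 1)) *
      (2 * derivWithin (g i) (Ici 0) u) ≤ δ / (n + 1) * bigG g (unboundedIdx g) u := by
    intro i hi
    have h0 := zero_le_one.trans (one_le_bigG hg ((unboundedIdx g).erase i) hu0)
    rw [bigG] at h0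
    rw [bigG, ← Finset.mul_prod_erase _ _ hi, mul_comm, ← mul_assoc]
    refine mul_le_mul_of_nonneg_right ?_ h0
    have h3 := (div_lt_iff₀ (hu i hi).2).1 (hu i hi).1
    have : 0 < δ / (n + 1) := by positivity
    linarith
  refine (Finset.sum_le_sum h2).trans ?_
  rw [Finset.sum_const, nsmul_eq_mul, ← mul_assoc]
  refine mul_le_mul_of_nonneg_right ?_ (zero_le_one.trans hG)
  have hcard : ((unboundedIdx g).card : ℝ) ≤ n + 1 := by
    have : ((unboundedIdx g).card : ℝ) ≤ n := by
      exact_mod_cast (Finset.card_le_univ _).trans_eq (by simp)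
    linarith
  calc ((unboundedIdx g).card : ℝ) * (δ / (n + 1)) ≤ (n + 1) * (δ / (n + 1)) := by gcongr
    _ = δ := by field_simp

/-- Once $G_U'\le\delta G_U$, the function $\delta\int_0^wG_U-G_U(w)$ is nondecreasing. Before that
point $G_U$ is bounded by monotonicity. -/
theorem exists_bigG_le (hg : ∀ i, ∀ u, 0 ≤ u → 0 ≤ g i u)
    (hc : ∀ i, ContinuousOn (g i) (Ici 0)) (hm : ∀ i, MonotoneOn (g i) (Ici 0))
    (hs : ∀ i ∈ unboundedIdx g, SubexpCondition (g i)) {δ : ℝ} (hδ : 0 < δ) :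
    ∃ C, ∀ w, 0 ≤ w → bigG g (unboundedIdx g) w ≤
      C + δ * ∫ u in (0 : ℝ)..w, bigG g (unboundedIdx g) u := by
  obtain ⟨a, ha⟩ := eventually_atTop.1 (eventually_deriv_bigG_le hg hm hs hδ)
  set G := bigG g (unboundedIdx g) with hGdef
  have hG0 : ∀ u, 0 ≤ u → 0 ≤ G u := fun u hu => zero_le_one.trans (one_le_bigG hg _ hu)
  have hGm : MonotoneOn G (Ici 0) := monotoneOn_bigG hg hm _
  have hGc : ContinuousOn G (Ici 0) := continuousOn_bigG hc _
  have hΦ0 : ∀ w, 0 ≤ w → 0 ≤ ∫ u in (0 : ℝ)..w, G u := fun w hw =>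
    intervalIntegral.integral_nonneg hw fun u hu => hG0 u hu.1
  -- Starting at a positive point turns the one-sided derivatives on $[0,\infty)$ into genuine ones.
  set b := max a 1 with hb
  have hb0 : 0 < b := lt_max_of_lt_right one_pos
  have hder : ∀ u, b < u → HasDerivAt (fun w => δ * (∫ v in (0 : ℝ)..w, G v) - G w)
      (δ * G u - ∑ i ∈ unboundedIdx g, (∏ l ∈ (unboundedIdx g).erase i, (2 * g l u + 1)) *
        (2 * derivWithin (g i) (Ici 0) u)) u := by
    intro u hu
    have hu0 : 0 < u := hb0.trans hu
    have hcont : ContinuousAt G u := hGc.continuousAt (Ici_mem_nhds hu0)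
    have h1 : HasDerivAt (fun w => ∫ v in (0 : ℝ)..w, G v) (G u) u :=
      intervalIntegral.integral_hasDerivAt_right
        (intervalIntegrable_of_monotoneOn_Ici hGm le_rfl hu0.le)
        ((hGc.mono Ioi_subset_Ici_self).stronglyMeasurableAtFilter isOpen_Ioi u hu0) hcont
    exact (h1.const_mul δ).sub (hasDerivAt_bigG hs hu0)
  have hmono : MonotoneOn (fun w => δ * (∫ v in (0 : ℝ)..w, G v) - G w) (Ici b) := by
    refine monotoneOn_of_deriv_nonneg (convex_Ici b) ?_ ?_ ?_
    · refine ContinuousOn.sub (continuousOn_const.mul ?_) (hGc.mono (Ici_subset_Ici.2 hb0.le))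
      intro u hu
      have hu1 : (0 : ℝ) ≤ u + 1 := by
        have : b ≤ u := hu
        linarith
      have hcu := intervalIntegral.continuousOn_primitive_interval'
        (intervalIntegrable_of_monotoneOn_Ici hGm le_rfl hu1) left_mem_uIcc
      refine ((hcu u ?_).mono_of_mem_nhdsWithin ?_)
      · rw [uIcc_of_le hu1]
        exact ⟨hb0.le.trans hu, by linarith⟩
      · rw [uIcc_of_le hu1]
        refine mem_nhdsWithin_of_mem_nhds (Icc_mem_nhds (hb0.trans_le hu) (by linarith))
    · intro u hu
      rw [interior_Ici] at hu
      exact (hder u hu).differentiableAt.differentiableWithinAt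
    · intro u hu
      rw [interior_Ici] at hu
      rw [(hder u hu).deriv]
      exact sub_nonneg.2 (ha u ((le_max_left _ _).trans hu.le))
  refine ⟨G b, fun w hw => ?_⟩
  rcases le_total w b with hwb | hbw
  · have := mul_nonneg hδ.le (hΦ0 w hw)
    linarith [hGm hw hb0.le hwb]
  · have h1 := hmono (mem_Ici.2 le_rfl) hbw hbw
    have h2 := mul_nonneg hδ.le (hΦ0 b hb0.le)
    simp only at h1
    linarith

theorem exists_hatG_le (hg : ∀ i, ∀ u, 0 ≤ u → 0 ≤ g i u)
    (hm : ∀ i, MonotoneOn (g i) (Ici 0)) {δ : ℝ} (hδ : 0 < δ) :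
    ∃ C, ∀ w, 0 ≤ w → hatG g (unboundedIdx g) w ≤
      C + δ * ∫ u in (0 : ℝ)..w, bigG g (unboundedIdx g) u := by
  obtain ⟨a, ha⟩ := eventually_atTop.1 (eventually_faceG_le hg hm hδ)
  have hFm := monotoneOn_faceG hg hm (unboundedIdx g)
  have hGm := monotoneOn_bigG hg hm (unboundedIdx g)
  have hF0 := fun u (hu : (0 : ℝ) ≤ u) => faceG_nonneg hg (unboundedIdx g) hu
  have hG0 : ∀ u, 0 ≤ u → 0 ≤ bigG g (unboundedIdx g) u :=
    fun u hu => zero_le_one.trans (one_le_bigG hg _ hu)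
  set b := max a 0
  have hb0 : 0 ≤ b := le_max_right _ _
  simp_rw [hatG_eq]
  refine ⟨∫ v in (0 : ℝ)..b, faceG g (unboundedIdx g) v, fun w hw => ?_⟩
  rw [← intervalIntegral.integral_const_mul]
  rcases le_total w b with hwb | hbw
  · have h1 := intervalIntegral.integral_add_adjacent_intervals
      (intervalIntegrable_of_monotoneOn_Ici hFm le_rfl hw)
      (intervalIntegrable_of_monotoneOn_Ici hFm hw hb0)
    have h2 := intervalIntegral.integral_nonneg (μ := volume) hwb
      fun u hu => hF0 u (hw.trans hu.1)
    have h3 := intervalIntegral.integral_nonneg (μ := volume) hw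
      fun u hu => mul_nonneg hδ.le (hG0 u hu.1)
    linarith
  · have hGi := fun a b (ha : (0 : ℝ) ≤ a) (hb : (0 : ℝ) ≤ b) =>
      (intervalIntegrable_of_monotoneOn_Ici hGm ha hb).const_mul δ
    rw [← intervalIntegral.integral_add_adjacent_intervals
      (intervalIntegrable_of_monotoneOn_Ici hFm le_rfl hb0)
      (intervalIntegrable_of_monotoneOn_Ici hFm hb0 hw),
      ← intervalIntegral.integral_add_adjacent_intervals (hGi 0 b le_rfl hb0) (hGi b w hb0 hw)]
    have h2 := intervalIntegral.integral_mono_on (μ := volume) hbw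
      (intervalIntegrable_of_monotoneOn_Ici hFm hb0 hw) (hGi b w hb0 hw)
      fun u hu => ha u ((le_max_left _ _).trans hu.1)
    have h3 := intervalIntegral.integral_nonneg (μ := volume) hb0
      fun u hu => mul_nonneg hδ.le (hG0 u hu.1)
    linarith

end Subexponential

/-! ### From pointwise growth bounds to the vanishing of the mean error. -/

theorem hatG_nonneg {n : ℕ} {g : Fin n → ℝ → ℝ} (hg : ∀ i, ∀ u, 0 ≤ u → 0 ≤ g i u)
    (A : Finset (Fin n)) {w : ℝ} (hw : 0 ≤ w) : 0 ≤ hatG g A w :=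
  intervalIntegral.integral_nonneg hw fun _ hu => faceG_nonneg hg A hu.1

theorem meanError_eq {n : ℕ} (g : Fin n → ℝ → ℝ) (A : Finset (Fin n)) (s : ℝ≥0) (z : ℝ) :
    meanError g A s z = ∫⁻ k in {k : ℤ | z < (k : ℝ)},
      (ENNReal.ofReal (bigG g A (k - z)) + ENNReal.ofReal (hatG g A (k - z))) ∂(srwLaw s) := by
  rw [lintegral_add_left (measurable_of_countable _)]
  rfl

theorem meanError_le {n : ℕ} {g : Fin n → ℝ → ℝ} (hg : ∀ i, ∀ u, 0 ≤ u → 0 ≤ g i u)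
    {A : Finset (Fin n)} {C δ : ℝ} (hδ : 0 ≤ δ)
    (h : ∀ w, 0 ≤ w → bigG g A w + hatG g A w ≤ C + δ * ∫ u in (0 : ℝ)..w, bigG g A u)
    (s : ℝ≥0) (z : ℝ) :
    meanError g A s z ≤ ENNReal.ofReal C * srwLaw s {k : ℤ | z < (k : ℝ)} +
      ENNReal.ofReal δ * meanIntG g A s z := by
  have h1 : ∀ k ∈ {k : ℤ | z < (k : ℝ)},
      ENNReal.ofReal (bigG g A (k - z)) + ENNReal.ofReal (hatG g A (k - z)) ≤
        ENNReal.ofReal C + ENNReal.ofReal δ *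
          ENNReal.ofReal (∫ u in (0 : ℝ)..(max ((k : ℝ) - z) 0), bigG g A u) := by
    intro k hk
    have hw : 0 ≤ (k : ℝ) - z := sub_nonneg.2 (le_of_lt hk)
    have hG := zero_le_one.trans (one_le_bigG hg A hw)
    rw [max_eq_left hw, ← ENNReal.ofReal_mul hδ, ← ENNReal.ofReal_add hG (hatG_nonneg hg A hw)]
    exact (ENNReal.ofReal_le_ofReal (h _ hw)).trans ENNReal.ofReal_add_le
  rw [meanError_eq]
  refine (setLIntegral_mono' MeasurableSet.of_discrete h1).trans ?_
  rw [lintegral_add_left measurable_const, setLIntegral_const,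
    lintegral_const_mul _ (measurable_of_countable _)]
  gcongr
  exact setLIntegral_le_lintegral _ _

/-- Beyond `z` the walk is either at one of the next `h` sites or at distance at least `h`. In the
latter case the integral is at least `h`, as $G_A\ge1$, and Markov's inequality applies. -/
theorem srwLaw_beyond_le {n : ℕ} {g : Fin n → ℝ → ℝ} (hg : ∀ i, ∀ u, 0 ≤ u → 0 ≤ g i u)
    (hm : ∀ i, MonotoneOn (g i) (Ici 0)) (A : Finset (Fin n)) (s : ℝ≥0) (z : ℝ) {h : ℕ}
    (hh : h ≠ 0) :
    srwLaw s {k : ℤ | z < (k : ℝ)} ≤ h * (⨆ k : ℤ, srwLaw s {k}) + meanIntG g A s z / h := by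
  have hsub : {k : ℤ | z < (k : ℝ)} ⊆ (Finset.Ioc ⌊z⌋ (⌊z⌋ + h) : Finset ℤ) ∪
      {k : ℤ | (h : ℝ≥0∞) ≤
        ENNReal.ofReal (∫ u in (0 : ℝ)..(max ((k : ℝ) - z) 0), bigG g A u)} := by
    intro k hk
    by_cases hk2 : k ≤ ⌊z⌋ + h
    · left
      rw [Finset.mem_coe, Finset.mem_Ioc]
      exact ⟨Int.floor_lt.2 hk, hk2⟩
    · right
      have hw : (h : ℝ) ≤ (k : ℝ) - z := by
        have h1 : ((⌊z⌋ + h + 1 : ℤ) : ℝ) ≤ k := by exact_mod_cast not_le.1 hk2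
        push_cast at h1
        linarith [Int.lt_floor_add_one z]
      have hw0 : 0 ≤ (k : ℝ) - z := (Nat.cast_nonneg h).trans hw
      rw [mem_ofPred_eq, max_eq_left hw0, ← ENNReal.ofReal_natCast]
      refine ENNReal.ofReal_le_ofReal (hw.trans ?_)
      have h2 := intervalIntegral.integral_mono_on (μ := volume) hw0
        (intervalIntegrable_const (c := (1 : ℝ)))
        (intervalIntegrable_of_monotoneOn_Ici (monotoneOn_bigG hg hm A) le_rfl hw0)
        fun u hu => one_le_bigG hg A hu.1
      simpa using h2
  refine (measure_mono hsub).trans ((measure_union_le _ _).trans (add_le_add ?_ ?_))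
  · rw [← sum_measure_singleton]
    refine (Finset.sum_le_sum fun k _ => le_iSup (fun k : ℤ => srwLaw s {k}) k).trans_eq ?_
    rw [Finset.sum_const, Int.card_Ioc, add_sub_cancel_left, Int.toNat_natCast, nsmul_eq_mul]
  · exact meas_ge_le_lintegral_div (measurable_of_countable _).aemeasurable
      (by exact_mod_cast hh) (by simp)

theorem tendsto_srwLaw_beyond {n : ℕ} {g : Fin n → ℝ → ℝ} (hg : ∀ i, ∀ u, 0 ≤ u → 0 ≤ g i u)
    (hm : ∀ i, MonotoneOn (g i) (Ici 0)) (A : Finset (Fin n)) {s : ℝ≥0 → ℝ≥0}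
    (hs : Tendsto s atTop atTop) {z : ℝ≥0 → ℝ}
    (hfin : ⨆ t, meanIntG g A (s t) (z t) < ⊤) :
    Tendsto (fun t => srwLaw (s t) {k : ℤ | z t < (k : ℝ)}) atTop (𝓝 0) := by
  rw [ENNReal.tendsto_nhds_zero]
  intro ε hε
  have hε2 : 0 < ε / 2 := ENNReal.half_pos hε.ne'
  set K := ⨆ t, meanIntG g A (s t) (z t)
  -- The window `h` is fixed first, uniformly in time; the spreading of the walk then makes the
  -- window unlikely.
  obtain ⟨h, hh0, hh⟩ : ∃ h : ℕ, h ≠ 0 ∧ K / h ≤ ε / 2 := by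
    have h1 : Tendsto (fun h : ℕ => K / (h : ℝ≥0∞)) atTop (𝓝 0) := by
      have := ENNReal.Tendsto.const_mul (a := K) ENNReal.tendsto_inv_nat_nhds_zero
        (Or.inr hfin.ne)
      simpa [div_eq_mul_inv] using this
    obtain ⟨h, h2, h3⟩ := ((ENNReal.tendsto_nhds_zero.1 h1 _ hε2).and
      (eventually_ne_atTop 0)).exists
    exact ⟨h, h3, h2⟩
  have h2 : Tendsto (fun t => (h : ℝ≥0∞) * ⨆ k : ℤ, srwLaw (s t) {k}) atTop (𝓝 0) := by
    have := ENNReal.Tendsto.const_mul (a := (h : ℝ≥0∞))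
      (tendsto_iSup_srwLaw_singleton.comp hs) (Or.inr (by simp))
    simpa using this
  filter_upwards [ENNReal.tendsto_nhds_zero.1 h2 _ hε2] with t ht
  refine (srwLaw_beyond_le hg hm A (s t) (z t) hh0).trans ?_
  rw [← ENNReal.add_halves ε]
  refine add_le_add ht (le_trans ?_ hh)
  gcongr
  exact le_iSup (fun t => meanIntG g A (s t) (z t)) t

/-- The order of choices matters: `δ` is fixed by the supremum of the main term, which determines
the constants `C₁` and `C₂`; only then is `t` taken large, so that the probability of being beyond
`z` beats them. -/
theorem tendsto_meanError {n : ℕ} {g : Fin n → ℝ → ℝ} (hg : ∀ i, ∀ u, 0 ≤ u → 0 ≤ g i u)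
    (hc : ∀ i, ContinuousOn (g i) (Ici 0)) (hm : ∀ i, MonotoneOn (g i) (Ici 0))
    (hsub : ∀ i ∈ unboundedIdx g, SubexpCondition (g i)) {s : ℝ≥0 → ℝ≥0}
    (hs : Tendsto s atTop atTop) {z : ℝ≥0 → ℝ}
    (hfin : ⨆ t, meanIntG g (unboundedIdx g) (s t) (z t) < ⊤) :
    Tendsto (fun t => meanError g (unboundedIdx g) (s t) (z t)) atTop (𝓝 0) := by
  rw [ENNReal.tendsto_nhds_zero]
  intro ε hε
  have hε2 : 0 < ε / 2 := ENNReal.half_pos hε.ne'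
  obtain ⟨δ, hδ0, hδ⟩ : ∃ δ : ℝ, 0 < δ ∧
      ENNReal.ofReal δ * (⨆ t, meanIntG g (unboundedIdx g) (s t) (z t)) ≤ ε / 2 := by
    have h1 : Tendsto (fun δ : ℝ => ENNReal.ofReal δ *
        ⨆ t, meanIntG g (unboundedIdx g) (s t) (z t)) (𝓝[>] 0) (𝓝 0) := by
      have h2 : Tendsto (fun δ : ℝ => ENNReal.ofReal δ) (𝓝[>] 0) (𝓝 0) := by
        have := (ENNReal.continuous_ofReal.tendsto 0).mono_left (nhdsWithin_le_nhds (s := Ioi 0))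
        simpa using this
      have := ENNReal.Tendsto.mul_const h2 (Or.inr hfin.ne)
      simpa using this
    obtain ⟨δ, h2, h3⟩ := ((ENNReal.tendsto_nhds_zero.1 h1 _ hε2).and
      self_mem_nhdsWithin).exists
    exact ⟨δ, h3, h2⟩
  obtain ⟨C₁, h₁⟩ := exists_bigG_le hg hc hm hsub (half_pos hδ0)
  obtain ⟨C₂, h₂⟩ := exists_hatG_le hg hm (half_pos hδ0)
  have h3 : Tendsto (fun t => ENNReal.ofReal (C₁ + C₂) * srwLaw (s t) {k : ℤ | z t < (k : ℝ)})
      atTop (𝓝 0) := by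
    have := ENNReal.Tendsto.const_mul (a := ENNReal.ofReal (C₁ + C₂))
      (tendsto_srwLaw_beyond hg hm (unboundedIdx g) hs hfin) (Or.inr (by simp))
    simpa using this
  filter_upwards [ENNReal.tendsto_nhds_zero.1 h3 _ hε2] with t ht
  refine (meanError_le (C := C₁ + C₂) hg hδ0.le (fun w hw => ?_) (s t) (z t)).trans ?_
  · linarith [h₁ w hw, h₂ w hw]
  · rw [← ENNReal.add_halves ε]
    refine add_le_add ht (le_trans ?_ hδ)
    gcongr
    exact le_iSup (fun t => meanIntG g (unboundedIdx g) (s t) (z t)) t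

/-! ### Assembly of the two-sided estimate. -/

theorem exists_profileCount_bounds {n : ℕ} {g : Fin n → ℝ → ℝ}
    (hg : ∀ i, ∀ u, 0 ≤ u → 0 ≤ g i u) (hm : ∀ i, MonotoneOn (g i) (Ici 0)) :
    ∃ L : Fin n → ℝ,
      (∀ i ∈ (unboundedIdx g)ᶜ, Tendsto (fun u : ℝ => 2 * (⌊g i u⌋ : ℝ) + 1) atTop (𝓝 (L i))) ∧
      ∃ C : ℝ, 0 < C ∧ ∀ w : ℝ, 0 < w →
        ∑ j ∈ Finset.range ⌈w⌉₊, layerCount g j ≤ (∏ i ∈ (unboundedIdx g)ᶜ, L i) *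
            (∫ u in (0 : ℝ)..w, bigG g (unboundedIdx g) u) +
          C * (bigG g (unboundedIdx g) w + hatG g (unboundedIdx g) w) ∧
        (∏ i ∈ (unboundedIdx g)ᶜ, L i) * (∫ u in (0 : ℝ)..w, bigG g (unboundedIdx g) u) ≤
          ∑ j ∈ Finset.range ⌈w⌉₊, layerCount g j +
            C * (bigG g (unboundedIdx g) w + hatG g (unboundedIdx g) w) := by
  obtain ⟨L, u₀, hL⟩ := exists_layer_limits hm
  have hL1 := fun i hi => (hL i hi).1
  have hL2 := fun i hi => (hL i hi).2
  have hΛ := one_le_prod_limits hg hL1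
  -- One constant serves both bounds: the lower one needs `⌈u₀⌉₊ + 2 * n + 1` in front of $G_U$ and
  -- `2` in front of $\widehat G_U$, the upper one only `1` in front of $G_U$, all times the product
  -- of the limits.
  refine ⟨L, fun i hi => tendsto_const_nhds.congr' ?_,
    (∏ i ∈ (unboundedIdx g)ᶜ, L i) * (⌈u₀⌉₊ + 2 * n + 2), by positivity, fun w hw => ?_⟩
  · filter_upwards [eventually_ge_atTop u₀] with u hu
    exact (hL2 i hi u hu).symm
  have hG := zero_le_one.trans (one_le_bigG hg (unboundedIdx g) hw.le)
  have hH := hatG_nonneg hg (unboundedIdx g) hw.le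
  have hΛ0 := zero_le_one.trans hΛ
  have hc : (0 : ℝ) ≤ ⌈u₀⌉₊ + 2 * n := by positivity
  constructor
  · refine (sum_layerCount_le hg hm hL1 hw).trans ?_
    rw [mul_add, mul_assoc]
    refine add_le_add le_rfl (mul_le_mul_of_nonneg_left ?_ hΛ0)
    nlinarith [mul_nonneg hc hG, mul_nonneg hc hH]
  · refine (le_sum_layerCount_add hg hm hL1 hL2 hw).trans ?_
    rw [mul_assoc]
    refine add_le_add le_rfl (mul_le_mul_of_nonneg_left ?_ hΛ0)
    nlinarith [mul_nonneg hc hG, mul_nonneg hc hH]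

/-- Integration of pointwise bounds of the form `p ≤ q + C * e` with an error that is supported on
the sites beyond `z`. -/
theorem lintegral_le_add_meanError {n : ℕ} {g : Fin n → ℝ → ℝ} {A : Finset (Fin n)} {s : ℝ≥0}
    {z C : ℝ} {p q : ℤ → ℝ≥0∞} (h0 : ∀ k : ℤ, (k : ℝ) ≤ z → p k ≤ q k)
    (h : ∀ k : ℤ, z < (k : ℝ) → p k ≤ q k + ENNReal.ofReal C *
      (ENNReal.ofReal (bigG g A (k - z)) + ENNReal.ofReal (hatG g A (k - z)))) :
    ∫⁻ k, p k ∂(srwLaw s) ≤ ∫⁻ k, q k ∂(srwLaw s) + ENNReal.ofReal C * meanError g A s z := by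
  rw [meanError_eq, ← lintegral_indicator MeasurableSet.of_discrete,
    ← lintegral_const_mul _ (measurable_of_countable _),
    ← lintegral_add_left (measurable_of_countable _)]
  refine lintegral_mono fun k => ?_
  by_cases hk : z < (k : ℝ)
  · rw [indicator_of_mem (show k ∈ {k : ℤ | z < (k : ℝ)} from hk)]
    exact h k hk
  · exact (h0 k (not_lt.1 hk)).trans le_self_add

theorem lemma3p2 (n : ℕ) (hn : 1 ≤ n) (g : Fin n → ℝ → ℝ)
    (hg_nonneg : ∀ i, ∀ u, 0 ≤ u → 0 ≤ g i u)
    (hg_cont : ∀ i, ContinuousOn (g i) (Ici 0))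
    (hg_mono : ∀ i, MonotoneOn (g i) (Ici 0)) :
    (∃ L : Fin n → ℝ,
      (∀ i ∈ (unboundedIdx g)ᶜ,
        Tendsto (fun u : ℝ => 2 * (⌊g i u⌋ : ℝ) + 1) atTop (𝓝 (L i))) ∧
      ∃ C : ℝ, 0 < C ∧
        ∀ (Ω : Type*) [MeasurableSpace Ω] (P : Measure Ω) [IsProbabilityMeasure P]
          (η : ℝ≥0 → Ω → Config (n + 1)), IsExclusionProcess (n + 1) P η (shapeProfile g) →
        ∀ (z : ℝ≥0 → ℝ) (t : ℝ≥0),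
          ((∫⁻ ω, numBeyond (η t ω) (z t) ∂P) ≤
            ENNReal.ofReal (∏ i ∈ (unboundedIdx g)ᶜ, L i) *
                meanIntG g (unboundedIdx g) (t / ((n + 1 : ℕ) : ℝ≥0)) (z t) +
              ENNReal.ofReal C *
                meanError g (unboundedIdx g) (t / ((n + 1 : ℕ) : ℝ≥0)) (z t)) ∧
          (ENNReal.ofReal (∏ i ∈ (unboundedIdx g)ᶜ, L i) *
                meanIntG g (unboundedIdx g) (t / ((n + 1 : ℕ) : ℝ≥0)) (z t) ≤
            (∫⁻ ω, numBeyond (η t ω) (z t) ∂P) +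
              ENNReal.ofReal C *
                meanError g (unboundedIdx g) (t / ((n + 1 : ℕ) : ℝ≥0)) (z t)) ∧
          (meanError g (unboundedIdx g) (t / ((n + 1 : ℕ) : ℝ≥0)) (z t) < ⊤ →
            (∫⁻ ω, numBeyond (η t ω) (z t) ∂P) < ⊤ ∧
            meanIntG g (unboundedIdx g) (t / ((n + 1 : ℕ) : ℝ≥0)) (z t) < ⊤)) ∧
    (∀ z : ℝ≥0 → ℝ,
      (∀ i ∈ unboundedIdx g, SubexpCondition (g i)) →
      (⨆ t : ℝ≥0, meanIntG g (unboundedIdx g) (t / ((n + 1 : ℕ) : ℝ≥0)) (z t)) < ⊤ →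
      Tendsto (fun t : ℝ≥0 => meanError g (unboundedIdx g) (t / ((n + 1 : ℕ) : ℝ≥0)) (z t))
        atTop (𝓝 0)) := by
  refine ⟨?_, fun z hsub hfin => tendsto_meanError hg_nonneg hg_cont hg_mono hsub ?_ hfin⟩
  swap
  · exact Filter.Tendsto.atTop_div_const (by positivity) tendsto_id
  obtain ⟨L, hL, C, hC, hbound⟩ := exists_profileCount_bounds hg_nonneg hg_mono
  refine ⟨L, hL, C, hC, fun Ω _ P _ η hη z t => ?_⟩
  set s : ℝ≥0 := t / ((n + 1 : ℕ) : ℝ≥0)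
  set Λ : ℝ := ∏ i ∈ (unboundedIdx g)ᶜ, L i
  have hG : ∀ w, 0 < w → 0 ≤ bigG g (unboundedIdx g) w := fun w hw =>
    zero_le_one.trans (one_le_bigG hg_nonneg _ hw.le)
  have hH : ∀ w, 0 < w → 0 ≤ hatG g (unboundedIdx g) w := fun w hw =>
    hatG_nonneg hg_nonneg _ hw.le
  have hΦ : ∀ w, 0 < w → 0 ≤ ∫ u in (0 : ℝ)..w, bigG g (unboundedIdx g) u := fun w hw =>
    intervalIntegral.integral_nonneg hw.le fun u hu =>
      zero_le_one.trans (one_le_bigG hg_nonneg _ hu.1)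
  have hN : ∀ w : ℝ, 0 ≤ ∑ j ∈ Finset.range ⌈w⌉₊, layerCount g j := fun w =>
    Finset.sum_nonneg fun j _ => layerCount_nonneg hg_nonneg (Nat.cast_nonneg j)
  -- Both quantities vanish unless the walk is beyond `z`, so no error is needed on the complement.
  have hzero : ∀ k : ℤ, (k : ℝ) ≤ z t → profileCount g (k - z t) = 0 ∧
      ENNReal.ofReal (∫ u in (0 : ℝ)..(max ((k : ℝ) - z t) 0), bigG g (unboundedIdx g) u) = 0 := by
    intro k hk
    rw [profileCount_eq hg_nonneg, Nat.ceil_eq_zero.2 (by linarith), max_eq_right (by linarith)]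
    simp
  have hΛ : 0 ≤ Λ := Finset.prod_nonneg fun i hi => ge_of_tendsto (hL i hi)
    ((eventually_ge_atTop 0).mono fun u hu =>
      zero_le_one.trans (one_le_floor_factor hg_nonneg i hu))
  have hmeas : ENNReal.ofReal Λ * meanIntG g (unboundedIdx g) s (z t) =
      ∫⁻ k : ℤ, ENNReal.ofReal Λ * ENNReal.ofReal
        (∫ u in (0 : ℝ)..(max ((k : ℝ) - z t) 0), bigG g (unboundedIdx g) u) ∂(srwLaw s) := by
    rw [lintegral_const_mul _ (measurable_of_countable _), meanIntG]
  have upper : ∫⁻ ω, numBeyond (η t ω) (z t) ∂P ≤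
      ENNReal.ofReal Λ * meanIntG g (unboundedIdx g) s (z t) +
        ENNReal.ofReal C * meanError g (unboundedIdx g) s (z t) := by
    rw [lintegral_numBeyond g hg_nonneg hη, hmeas]
    refine lintegral_le_add_meanError (fun k hk => by simp [hzero k hk]) fun k hk => ?_
    have hw : 0 < (k : ℝ) - z t := sub_pos.2 hk
    rw [profileCount_eq hg_nonneg, max_eq_left hw.le, ← ENNReal.ofReal_mul hΛ,
      ← ENNReal.ofReal_add (hG _ hw) (hH _ hw), ← ENNReal.ofReal_mul hC.le,
      ← ENNReal.ofReal_add (mul_nonneg hΛ (hΦ _ hw))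
        (mul_nonneg hC.le (add_nonneg (hG _ hw) (hH _ hw)))]
    exact ENNReal.ofReal_le_ofReal (hbound _ hw).1
  have lower : ENNReal.ofReal Λ * meanIntG g (unboundedIdx g) s (z t) ≤
      ∫⁻ ω, numBeyond (η t ω) (z t) ∂P +
        ENNReal.ofReal C * meanError g (unboundedIdx g) s (z t) := by
    rw [lintegral_numBeyond g hg_nonneg hη, hmeas]
    refine lintegral_le_add_meanError (fun k hk => by simp [hzero k hk]) fun k hk => ?_
    have hw : 0 < (k : ℝ) - z t := sub_pos.2 hk
    rw [profileCount_eq hg_nonneg, max_eq_left hw.le, ← ENNReal.ofReal_mul hΛ,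
      ← ENNReal.ofReal_add (hG _ hw) (hH _ hw), ← ENNReal.ofReal_mul hC.le,
      ← ENNReal.ofReal_add (hN _) (mul_nonneg hC.le (add_nonneg (hG _ hw) (hH _ hw)))]
    exact ENNReal.ofReal_le_ofReal (hbound _ hw).2
  refine ⟨upper, lower, fun herr => ?_⟩
  -- The two-sided bounds alone would allow both terms to be infinite; finiteness comes from the
  -- tail of the walk.
  have hint : meanIntG g (unboundedIdx g) s (z t) < ⊤ :=
    meanIntG_lt_top hg_nonneg hg_mono _ _ _ (lt_of_le_of_lt le_self_add herr)
  exact ⟨upper.trans_lt (ENNReal.add_lt_top.2 ⟨ENNReal.mul_lt_top ENNReal.ofReal_lt_top hint,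
    ENNReal.mul_lt_top ENNReal.ofReal_lt_top herr⟩), hint⟩
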